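/- **Theorem 1.1.** Let $J\subset\mathbb R$ be a bounded interval of positive length and let $p:J\to\mathbb R$ satisfy $1<p_-\le p(x)\le p_+<\infty$ for all $x\in J$, with constants $p_-,p_+$. Suppose that $p$ is locally log-Hölder continuous on $J$: there is $C>0$ such that $|p(x)-p(y)|\le \dfrac{C}{-\ln|x-y|}$ for all $x,y\in J$ with $0<|x-y|\le \tfrac12$. Put $p'(x)=\frac{p(x)}{p(x)-1}$ and let $0\le\alpha<1$. Let $v,w$ be real-valued measurable functions on $J$ such that $w>0$ a.e. on $J$, $v\ge 0$ a.e. on $J$ and $v$ is not a.e. zero on $J$. Put $\sigma=w^{-p'(\cdot)}$ and suppose that the measure $\sigma\,dx$ is doubling on $J$: there is $b>0$ such that $$\int_{(x-2r,x+2r)\cap J}\sigma\le b\int_{(x-r,x+r)\cap J}\sigma\qquad\text{for all }x\in J,\ 0<r<|J|$$ (the integrals have values in $[0,\infty]$). For measurable $f$ on $J$ and $x\in J$ let $$M^{(J)}_\alpha f(x)=\sup_{I\ni x,\ I\subset J}\frac1{|I|^{1-\alpha}}\int_I|f(y)|\,dy,$$ the supremum being over intervals $I$ of positive length, and let $\|g\|_{L^{p(\cdot)}(J)}=\inf\{\lambda>0:\int_J|g(x)/\lambda|^{p(x)}dx\le1\}$,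 with $\inf\emptyset=\infty$. Then the following are equivalent (with the convention $0\cdot\infty=0$). (i) There is a constant $c>0$ such that $\|v\,M^{(J)}_\alpha f\|_{L^{p(\cdot)}(J)}\le c\,\|wf\|_{L^{p(\cdot)}(J)}$ for all measurable $f:J\to\mathbb R$. (ii) There is a constant $c>0$ such that for every interval $I\subset J$, $$\int_I v(x)^{p(x)}\big(M^{(J)}_\alpha(w^{-p'(\cdot)}\chi_I)(x)\big)^{p(x)}dx\le c\int_I w(x)^{-p'(x)}dx<\infty.$$ -/

import Mathlib

open Set MeasureTheory
open scoped ENNReal NNReal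

noncomputable section

namespace VarExp

/-- The conjugate exponent `p'(x) = p(x) / (p(x) - 1)`. -/
def conjExp (p : ℝ → ℝ) (x : ℝ) : ℝ := p x / (p x - 1)

/-- The modular `S_p(g) = ∫_J g(x)^{p(x)} dx` of a function with values in `[0, ∞]`
(applied to absolute values of functions). -/
def modular (J : Set ℝ) (p : ℝ → ℝ) (g : ℝ → ℝ≥0∞) : ℝ≥0∞ :=
  ∫⁻ x in J, g x ^ p x

/-- The Luxemburg norm `inf {l > 0 : S_p(g / l) ≤ 1}` of `L^{p(·)}(J)`. It is `∞` when there is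
no such `l`, that is, when `g` is not in the space. -/
def lpNorm (J : Set ℝ) (p : ℝ → ℝ) (g : ℝ → ℝ≥0∞) : ℝ≥0∞ :=
  ⨅ (l : ℝ≥0) (_ : 0 < l) (_ : modular J p (fun x => g x / (l : ℝ≥0∞)) ≤ 1), (l : ℝ≥0∞)

/-- The fractional maximal function on `J`: the supremum over all intervals `I` with
`x ∈ I ⊆ J` of `|I|^{-(1-α)} ∫_I g`, for `g ≥ 0`. A one-point interval contributes `0 / 0 = 0`. -/
def fracMaximal (J : Set ℝ) (α : ℝ) (g : ℝ → ℝ≥0∞) (x : ℝ) : ℝ≥0∞ :=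
  ⨆ (I : Set ℝ) (_ : I.OrdConnected) (_ : x ∈ I) (_ : I ⊆ J),
    (∫⁻ y in I, g y) / volume I ^ (1 - α)

/-- The doubling condition `u ∈ DC(J)` for the measure `u dx` on the bounded interval `J`. -/
def DoublingOn (J : Set ℝ) (u : ℝ → ℝ≥0∞) : Prop :=
  ∃ b : ℝ, 0 < b ∧ ∀ x ∈ J, ∀ r : ℝ, 0 < r → r < (volume J).toReal →
    ∫⁻ y in Ioo (x - 2 * r) (x + 2 * r) ∩ J, u y ≤
      ENNReal.ofReal b * ∫⁻ y in Ioo (x - r) (x + r) ∩ J, u y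

/-- The local log-Hölder condition `p ∈ LH(J)`. -/
def LogHolderOn (J : Set ℝ) (p : ℝ → ℝ) : Prop :=
  ∃ c : ℝ, 0 < c ∧ ∀ x ∈ J, ∀ y ∈ J, x ≠ y → |x - y| ≤ 1 / 2 →
    |p x - p y| ≤ c / (-Real.log |x - y|)

/-- The function `w^{-p'(·)}`, with values in `[0, ∞]`. -/
def dualWeight (p w : ℝ → ℝ) (x : ℝ) : ℝ≥0∞ :=
  ENNReal.ofReal (w x) ^ (-conjExp p x)

/-- The two-weight inequality `‖v M_α f‖ ≤ c ‖w f‖` in `L^{p(·)}(J)`, for all measurable `f`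
on `J`, with one constant. -/
def TwoWeightInequality (J : Set ℝ) (p : ℝ → ℝ) (α : ℝ) (v w : ℝ → ℝ) : Prop :=
  ∃ c : ℝ, 0 < c ∧ ∀ f : ℝ → ℝ, AEMeasurable f (volume.restrict J) →
    lpNorm J p (fun x => ENNReal.ofReal (v x) * fracMaximal J α (fun y => ‖f y‖ₑ) x) ≤
      ENNReal.ofReal c * lpNorm J p (fun x => ENNReal.ofReal (w x) * ‖f x‖ₑ)

/-- The testing condition: for one constant `c` and all intervals `I ⊆ J`,
`∫_I v^{p(x)} (M_α (w^{-p'} χ_I))^{p(x)} dx ≤ c ∫_I w^{-p'} < ∞`. -/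
def TestingCondition (J : Set ℝ) (p : ℝ → ℝ) (α : ℝ) (v w : ℝ → ℝ) : Prop :=
  ∃ c : ℝ, 0 < c ∧ ∀ I : Set ℝ, I.OrdConnected → I ⊆ J →
    (∫⁻ x in I, ENNReal.ofReal (v x) ^ p x *
        fracMaximal J α (I.indicator (dualWeight p w)) x ^ p x) ≤
      ENNReal.ofReal c * ∫⁻ x in I, dualWeight p w x ∧
    ∫⁻ x in I, dualWeight p w x < ∞

end VarExp

end

/-! Write `σ = w^(-p')`. Since `w^p σ^p = σ`, substituting `f = g σ` turns the modular of `w f` into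
the modular of `g` for the measure `σ dx`. The log-Hölder condition is used through one estimate.
Doubling bounds `σ(I)` below by a power of `|I| / |J|`, so `|log σ(I)|` is at most a constant plus a
multiple of `|log |I||`, while `p` oscillates on a short `I` by at most `C / |log |I||`. Hence
`osc_I p * |log σ(I)|` is bounded uniformly in `I` (`exists_oscillation_bound`), and exponents may
be frozen on `I` at the cost of a constant.

Necessity: testing on the truncations `min σ k` shows `σ(J) < ∞`, because `v` is not null. Then `f =
σ χ_I` is tested; `‖w f‖` is comparable with `σ(I)^(1/p(x₀))`, whose `p(x)`-th power is comparable
with `σ(I)` for every `x` in `I`, so the norm inequality becomes the testing inequality.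

Sufficiency: the maximal function is replaced by a supremum over countably many intervals `B i`.
With `q = p_-`, the variable-exponent Jensen inequality `rpow_lintegral_le_of_oscillation` bounds
`(v M_α f)^p` by a constant times `sup_i φ i * (A i)^q`, where `φ i` is `v^p (σ(B i) / |B
i|^(1-α))^p` on `B i` and `A i` is the `σ`-average over `B i` of a function `G` with `G^q`
controlled by `g^p + 1`. The testing condition is a Carleson-type condition on the `φ i`; a Vitali
selection gives a weak-type bound (`lintegral_iSup_indicator_le`), and integration over levels gives
the strong bound of exponent `q > 1` (`lintegral_iSup_mul_rpow_le`). -/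

namespace VarExp

/-! ### Doubling measures on a bounded interval -/

/-- A bounded interval of positive length agrees up to endpoints with an open interval
centred at one of its points. -/
lemma exists_center {I : Set ℝ} (hI : I.OrdConnected) (hb : Bornology.IsBounded I)
    (hv : volume I ≠ 0) :
    ∃ c r : ℝ, 0 < r ∧ c ∈ I ∧ Ioo (c - r) (c + r) ⊆ I ∧ I ⊆ Icc (c - r) (c + r) ∧
      volume I = ENNReal.ofReal (2 * r) := by
  have hne : I.Nonempty := by
    rw [nonempty_iff_ne_empty]
    rintro rfl
    simp at hv
  have hsub := subset_Icc_csInf_csSup hb.bddBelow hb.bddAbove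
  have hsup : Ioo (sInf I) (sSup I) ⊆ I := by
    intro x hx
    obtain ⟨y, hy, hyx⟩ := exists_lt_of_csInf_lt hne hx.1
    obtain ⟨z, hz, hxz⟩ := exists_lt_of_lt_csSup hne hx.2
    exact hI.out hy hz ⟨hyx.le, hxz.le⟩
  have hvol : volume I = ENNReal.ofReal (sSup I - sInf I) :=
    le_antisymm ((measure_mono hsub).trans_eq Real.volume_Icc)
      (Real.volume_Ioo.symm.trans_le (measure_mono hsup))
  have hlt : 0 < sSup I - sInf I := by
    by_contra h
    exact hv (hvol.trans (ENNReal.ofReal_eq_zero.2 (not_lt.1 h)))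
  have h1 : (sInf I + sSup I) / 2 - (sSup I - sInf I) / 2 = sInf I := by ring
  have h2 : (sInf I + sSup I) / 2 + (sSup I - sInf I) / 2 = sSup I := by ring
  refine ⟨(sInf I + sSup I) / 2, (sSup I - sInf I) / 2, by linarith,
    hsup ⟨by linarith, by linarith⟩, ?_, ?_, ?_⟩
  · rwa [h1, h2]
  · rwa [h1, h2]
  · rw [hvol]
    congr 1
    ring

lemma volume_ne_top_of_bounded {J : Set ℝ} (hJb : Bornology.IsBounded J) : volume J ≠ ∞ :=
  hJb.measure_lt_top.ne

lemma abs_sub_le_volume {J : Set ℝ} (hJ : J.OrdConnected) (hJb : Bornology.IsBounded J)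
    {x y : ℝ} (hx : x ∈ J) (hy : y ∈ J) : |x - y| ≤ (volume J).toReal := by
  have h : uIcc y x ⊆ J := hJ.uIcc_subset hy hx
  have h' := measure_mono (μ := volume) h
  rw [Real.volume_interval] at h'
  rwa [← ENNReal.ofReal_le_iff_le_toReal (volume_ne_top_of_bounded hJb)]

/-- The doubling inequality holds for all radii, with a constant of the form `2 ^ N`. -/
lemma DoublingOn.exists_pow {J : Set ℝ} (hJ : J.OrdConnected) (hJb : Bornology.IsBounded J)
    {u : ℝ → ℝ≥0∞} (hu : DoublingOn J u) :
    ∃ N : ℕ, ∀ x ∈ J, ∀ r : ℝ, 0 < r →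
      ∫⁻ y in Ioo (x - 2 * r) (x + 2 * r) ∩ J, u y ≤
        2 ^ N * ∫⁻ y in Ioo (x - r) (x + r) ∩ J, u y := by
  obtain ⟨b, hb, h⟩ := hu
  obtain ⟨N, hN⟩ := pow_unbounded_of_one_lt b one_lt_two
  refine ⟨N, fun x hx r hr => ?_⟩
  by_cases hrJ : r < (volume J).toReal
  · refine (h x hx r hr hrJ).trans ?_
    gcongr
    rw [ENNReal.ofReal_le_iff_le_toReal (by simp)]
    simpa using hN.le
  -- A radius `r ≥ |J|` already covers `J` up to the endpoints of the ball, so doubling it gains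
  -- nothing.
  · have h1 : (Ioo (x - 2 * r) (x + 2 * r) ∩ J : Set ℝ) ≤ᵐ[volume]
        (Ioo (x - r) (x + r) ∩ J : Set ℝ) := by
      have h2 : (Icc (x - r) (x + r) ∩ J : Set ℝ) =ᵐ[volume] (Ioo (x - r) (x + r) ∩ J : Set ℝ) :=
        Ioo_ae_eq_Icc.symm.inter (ae_eq_refl J)
      refine (LE.le.eventuallyLE ?_).trans h2.le
      rintro y ⟨-, hy⟩
      have := abs_le.1 ((abs_sub_le_volume hJ hJb hy hx).trans (not_lt.1 hrJ))
      exact ⟨⟨by linarith, by linarith⟩, hy⟩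
    refine (lintegral_mono_set' h1).trans ?_
    exact le_mul_of_one_le_left' (one_le_pow₀ (by norm_num))

/-- Iterated doubling. A constant of the form `2 ^ N` makes the total loss the `N`-th power of the
dilation factor, hence later a power of a ratio of lengths. -/
lemma lintegral_Ioo_two_pow_le {J : Set ℝ} {u : ℝ → ℝ≥0∞} {N : ℕ}
    (hN : ∀ x ∈ J, ∀ r : ℝ, 0 < r →
      ∫⁻ y in Ioo (x - 2 * r) (x + 2 * r) ∩ J, u y ≤
        2 ^ N * ∫⁻ y in Ioo (x - r) (x + r) ∩ J, u y)
    {x : ℝ} (hx : x ∈ J) {r : ℝ} (hr : 0 < r) (n : ℕ) :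
    ∫⁻ y in Ioo (x - 2 ^ n * r) (x + 2 ^ n * r) ∩ J, u y ≤
      (2 ^ n) ^ N * ∫⁻ y in Ioo (x - r) (x + r) ∩ J, u y := by
  induction n with
  | zero => simp
  | succ n ih =>
    have h := hN x hx (2 ^ n * r) (by positivity)
    have e : (2 : ℝ) * (2 ^ n * r) = 2 ^ (n + 1) * r := by ring
    rw [e] at h
    refine h.trans ((mul_le_mul_right ih _).trans_eq ?_)
    rw [pow_succ (2 : ℝ≥0∞) n, mul_pow, ← mul_assoc, mul_comm ((2 : ℝ≥0∞) ^ N)]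

/-- A doubling measure of a subinterval is bounded below by a power of its relative length. -/
lemma lintegral_le_of_doubling {J : Set ℝ} (hJ : J.OrdConnected) (hJb : Bornology.IsBounded J)
    {u : ℝ → ℝ≥0∞} {N : ℕ}
    (hN : ∀ x ∈ J, ∀ r : ℝ, 0 < r →
      ∫⁻ y in Ioo (x - 2 * r) (x + 2 * r) ∩ J, u y ≤
        2 ^ N * ∫⁻ y in Ioo (x - r) (x + r) ∩ J, u y)
    {I : Set ℝ} (hI : I.OrdConnected) (hIJ : I ⊆ J) (hv : volume I ≠ 0) :
    ∫⁻ y in J, u y ≤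
      ENNReal.ofReal ((4 * (volume J).toReal / (volume I).toReal) ^ N) * ∫⁻ y in I, u y := by
  obtain ⟨c, r, hr, hc, h1, -, h3⟩ := exists_center hI (hJb.subset hIJ) hv
  have hIr : (volume I).toReal = 2 * r := by rw [h3, ENNReal.toReal_ofReal (by positivity)]
  have hle : (volume I).toReal ≤ (volume J).toReal :=
    ENNReal.toReal_mono (volume_ne_top_of_bounded hJb) (measure_mono hIJ)
  set m := (volume J).toReal with hm
  have hx1 : 1 ≤ m / r := by
    rw [one_le_div hr]
    linarith
  -- `2 ^ (n + 1) * r` is a dyadic radius just exceeding `|J|`: the dilated ball contains `J`, and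
  -- `2 ^ (n + 1) ≤ 2 |J| / r = 4 |J| / |I|`.
  obtain ⟨n, hn1, hn2⟩ := exists_nat_pow_near hx1 one_lt_two
  have hJsub : J ⊆ Ioo (c - 2 ^ (n + 1) * r) (c + 2 ^ (n + 1) * r) ∩ J := by
    intro y hy
    have h4 := abs_sub_le_volume hJ hJb hy (hIJ hc)
    have h5 : m < 2 ^ (n + 1) * r := by rwa [div_lt_iff₀ hr] at hn2
    have := abs_le.1 h4
    exact ⟨⟨by linarith, by linarith⟩, hy⟩
  refine (lintegral_mono_set hJsub).trans
    ((lintegral_Ioo_two_pow_le hN (hIJ hc) hr (n + 1)).trans ?_)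
  refine mul_le_mul' ?_ (lintegral_mono_set (inter_subset_left.trans h1))
  have h6 : ((2 : ℝ≥0∞) ^ (n + 1)) ^ N = ENNReal.ofReal (((2 : ℝ) ^ (n + 1)) ^ N) := by
    rw [ENNReal.ofReal_pow (by positivity), ENNReal.ofReal_pow (by positivity)]
    simp
  rw [h6]
  refine ENNReal.ofReal_le_ofReal (pow_le_pow_left₀ (by positivity) ?_ _)
  rw [hIr, pow_succ]
  calc (2 : ℝ) ^ n * 2 ≤ m / r * 2 := by gcongr
    _ = 4 * m / (2 * r) := by
      field_simp
      ring

/-! ### Log-Hölder exponents and their oscillation -/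

/-- The modulus `c / (-log |x - y|)` tends to `0` at the diagonal. Continuity serves to make `p`
measurable on `J`. -/
lemma LogHolderOn.continuousOn {J : Set ℝ} {p : ℝ → ℝ} (h : LogHolderOn J p) :
    ContinuousOn p J := by
  obtain ⟨c, hc, h⟩ := h
  intro x hx
  rw [ContinuousWithinAt, tendsto_iff_dist_tendsto_zero]
  have hlim : Filter.Tendsto (fun y => c / (-Real.log |x - y|)) (nhdsWithin x {x}ᶜ) (nhds 0) := by
    have h1 : Filter.Tendsto (fun y : ℝ => x - y) (nhdsWithin x {x}ᶜ) (nhdsWithin 0 {0}ᶜ) := by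
      refine tendsto_nhdsWithin_of_tendsto_nhds_of_eventually_within _ ?_ ?_
      · have : Filter.Tendsto (fun y : ℝ => x - y) (nhds x) (nhds (x - x)) :=
          (continuous_const.sub continuous_id).tendsto x
        rw [sub_self] at this
        exact this.mono_left nhdsWithin_le_nhds
      · filter_upwards [self_mem_nhdsWithin] with y hy
        simpa [sub_eq_zero, eq_comm] using hy
    have h2 := Real.tendsto_log_nhdsNE_zero.comp h1
    have h3 := Filter.tendsto_neg_atBot_atTop.comp h2
    refine (Filter.Tendsto.const_div_atTop h3 c).congr fun y => ?_
    simp [Function.comp]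
  have hev : ∀ᶠ y in nhds x, |x - y| ≤ 1 / 2 := by
    filter_upwards [Metric.closedBall_mem_nhds x (by norm_num : (0 : ℝ) < 1 / 2)] with y hy
    rw [← Real.dist_eq, dist_comm]
    exact hy
  rw [Metric.tendsto_nhds] at hlim ⊢
  intro ε hε
  have h4 := hlim ε hε
  rw [eventually_nhdsWithin_iff] at h4 ⊢
  filter_upwards [h4, hev] with y hy1 hy2 hyJ
  by_cases hxy : x = y
  · simpa [hxy] using hε
  · have h5 := hy1 (by simpa [eq_comm] using hxy)
    have h6 := h x hx y hyJ hxy hy2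
    rw [Real.dist_eq] at h5
    simp only [sub_zero] at h5
    simp only [Real.dist_eq, sub_zero, abs_abs]
    rw [abs_sub_comm]
    exact h6.trans_lt ((le_abs_self _).trans_lt h5)

/-- The oscillation of the exponent on a subinterval `I` is at most a constant divided by
`|log ∫_I u|`, for a doubling density `u`. -/
lemma exists_oscillation_bound {J : Set ℝ} (hJ : J.OrdConnected) (hJb : Bornology.IsBounded J)
    {p : ℝ → ℝ} {pminus pplus : ℝ} (hp : ∀ x ∈ J, pminus ≤ p x ∧ p x ≤ pplus)
    (hpLH : LogHolderOn J p) {u : ℝ → ℝ≥0∞} (hu : DoublingOn J u)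
    (hu0 : ∫⁻ y in J, u y ≠ 0) (huT : ∫⁻ y in J, u y ≠ ∞) :
    ∃ L : ℝ, 0 ≤ L ∧ ∀ I : Set ℝ, I.OrdConnected → I ⊆ J → volume I ≠ 0 →
      ∃ ε : ℝ, 0 ≤ ε ∧ (∀ x ∈ I, ∀ y ∈ I, |p x - p y| ≤ ε) ∧
        ε * |Real.log (∫⁻ y in I, u y).toReal| ≤ L := by
  obtain ⟨N, hN⟩ := hu.exists_pow hJ hJb
  obtain ⟨c, hc, hLH⟩ := hpLH
  have hJne : J.Nonempty := by
    rw [nonempty_iff_ne_empty]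
    rintro rfl
    simp at hu0
  obtain ⟨z, hz⟩ := hJne
  have hpp : 0 ≤ pplus - pminus := by linarith [hp z hz]
  set m := (volume J).toReal with hm
  set T := (∫⁻ y in J, u y).toReal with hT
  have hTpos : 0 < T := ENNReal.toReal_pos hu0 huT
  set A := |Real.log T| + N * |Real.log (4 * m)| with hA
  have hA0 : 0 ≤ A := by positivity
  have hl2 : 0 < Real.log 2 := Real.log_pos one_lt_two
  refine ⟨c * A / Real.log 2 + N * c + (pplus - pminus) * (A + N * Real.log 2), by positivity,
    fun I hI hIJ hv => ?_⟩
  have hlow := lintegral_le_of_doubling hJ hJb hN hI hIJ hv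
  have hIle : ∫⁻ y in I, u y ≤ ∫⁻ y in J, u y := lintegral_mono_set hIJ
  have hIT : ∫⁻ y in I, u y ≠ ∞ := ne_top_of_le_ne_top huT hIle
  have hvT : volume I ≠ ∞ := volume_ne_top_of_bounded (hJb.subset hIJ)
  set δ := (volume I).toReal with hδ
  have hδpos : 0 < δ := ENNReal.toReal_pos hv hvT
  have hδm : δ ≤ m := ENNReal.toReal_mono (volume_ne_top_of_bounded hJb) (measure_mono hIJ)
  have hmpos : 0 < m := hδpos.trans_le hδm
  set S := (∫⁻ y in I, u y).toReal with hS
  have hTS : T ≤ (4 * m / δ) ^ N * S := by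
    have := ENNReal.toReal_mono (ENNReal.mul_ne_top ENNReal.ofReal_ne_top hIT) hlow
    rwa [ENNReal.toReal_mul, ENNReal.toReal_ofReal (by positivity)] at this
  have hST : S ≤ T := ENNReal.toReal_mono huT hIle
  have hSpos : 0 < S := by
    by_contra h
    have : (4 * m / δ) ^ N * S ≤ 0 := mul_nonpos_of_nonneg_of_nonpos (by positivity) (not_lt.1 h)
    linarith
  have hlog1 : Real.log T ≤ N * (Real.log (4 * m) - Real.log δ) + Real.log S := by
    have := Real.log_le_log hTpos hTS
    rwa [Real.log_mul (by positivity) hSpos.ne', Real.log_pow,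
      Real.log_div (by positivity) hδpos.ne'] at this
  have hlog2 : Real.log S ≤ Real.log T := Real.log_le_log hSpos hST
  have h4m := le_abs_self (Real.log (4 * m))
  have hN0 : (0 : ℝ) ≤ N := Nat.cast_nonneg N
  -- The log-Hölder bound speaks only of distances up to `1 / 2`. On short intervals the factor
  -- `-log δ` in the bound for `|log S|` cancels against `ε = c / (-log δ)`; on long ones `|log S|`
  -- is bounded and the trivial oscillation `pplus - pminus` suffices.
  by_cases hd : δ ≤ 1 / 2
  · have hld : Real.log 2 ≤ -Real.log δ := by
      rw [← Real.log_inv]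
      refine Real.log_le_log two_pos ?_
      rw [le_inv_comm₀ two_pos hδpos]
      linarith
    have hldpos : 0 < -Real.log δ := hl2.trans_le hld
    have hlogS : |Real.log S| ≤ A + N * (-Real.log δ) := by
      rw [abs_le]
      have := neg_abs_le (Real.log T)
      have := le_abs_self (Real.log T)
      have := mul_le_mul_of_nonneg_left h4m hN0
      have := mul_nonneg hN0 hldpos.le
      have := mul_nonneg hN0 (abs_nonneg (Real.log (4 * m)))
      constructor <;> nlinarith
    refine ⟨c / (-Real.log δ), by positivity, fun x hx y hy => ?_, ?_⟩
    · by_cases hxy : x = y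
      · simp only [hxy, sub_self, abs_zero]
        positivity
      · have hxy' : |x - y| ≤ δ := abs_sub_le_volume hI (hJb.subset hIJ) hx hy
        refine (hLH x (hIJ hx) y (hIJ hy) hxy (hxy'.trans hd)).trans ?_
        refine div_le_div_of_nonneg_left hc.le hldpos (neg_le_neg ?_)
        exact Real.log_le_log (abs_pos.2 (sub_ne_zero.2 hxy)) hxy'
    · calc c / (-Real.log δ) * |Real.log S| ≤ c / (-Real.log δ) * (A + N * (-Real.log δ)) := by
            gcongr
        _ = c * A / (-Real.log δ) + N * c := by
            have := hldpos.ne'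
            generalize -Real.log δ = l at this
            field_simp
        _ ≤ c * A / Real.log 2 + N * c := by gcongr
        _ ≤ _ := le_add_of_nonneg_right (by positivity)
  · have hld : -Real.log δ ≤ Real.log 2 := by
      rw [← Real.log_inv]
      refine Real.log_le_log (inv_pos.2 hδpos) ?_
      rw [inv_le_comm₀ hδpos two_pos]
      linarith
    have hlogS : |Real.log S| ≤ A + N * Real.log 2 := by
      rw [abs_le]
      have := neg_abs_le (Real.log T)
      have := le_abs_self (Real.log T)
      have := mul_le_mul_of_nonneg_left h4m hN0
      have := mul_le_mul_of_nonneg_left hld hN0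
      have := mul_nonneg hN0 hl2.le
      have := mul_nonneg hN0 (abs_nonneg (Real.log (4 * m)))
      constructor <;> nlinarith
    refine ⟨pplus - pminus, hpp, fun x hx y hy => ?_, ?_⟩
    · have := hp x (hIJ hx)
      have := hp y (hIJ hy)
      rw [abs_le]
      constructor <;> linarith
    · calc (pplus - pminus) * |Real.log S| ≤ (pplus - pminus) * (A + N * Real.log 2) := by gcongr
        _ ≤ _ := le_add_of_nonneg_left (by positivity)

/-! ### Jensen's inequality with a variable exponent -/

lemma rpow_lintegral_le {X : Type*} [MeasurableSpace X] (μ : Measure X) [IsProbabilityMeasure μ]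
    {g : X → ℝ≥0∞} (hg : AEMeasurable g μ) {r : ℝ} (hr : 1 ≤ r) :
    (∫⁻ x, g x ∂μ) ^ r ≤ ∫⁻ x, g x ^ r ∂μ := by
  have h := eLpNorm'_le_eLpNorm'_of_exponent_le one_pos hr μ hg.aestronglyMeasurable
  simp only [eLpNorm', enorm_eq_self, ENNReal.rpow_one, div_one] at h
  have hr0 : 0 < r := by linarith
  calc (∫⁻ x, g x ∂μ) ^ r ≤ ((∫⁻ x, g x ^ r ∂μ) ^ (1 / r)) ^ r := by gcongr
    _ = ∫⁻ x, g x ^ r ∂μ := by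
      rw [← ENNReal.rpow_mul, one_div_mul_cancel hr0.ne', ENNReal.rpow_one]

/-- The pointwise Jensen-type inequality for averages with a variable exponent whose oscillation
is controlled by the size of the modular. -/
lemma rpow_lintegral_le_of_oscillation {X : Type*} [MeasurableSpace X] (μ : Measure X)
    [IsProbabilityMeasure μ] {g : X → ℝ≥0∞} (hg : AEMeasurable g μ) {p : X → ℝ}
    {q P Q ε H L : ℝ} (hq : 1 ≤ q) (hqP : q ≤ P) (hPQ : P ≤ Q)
    (hε : 0 ≤ ε) (hH : 0 ≤ H) (hεH : ε * H ≤ L)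
    (hp : ∀ᵐ y ∂μ, q ≤ p y ∧ P - ε ≤ p y)
    (hgp : ∫⁻ y, g y ^ p y ∂μ ≤ ENNReal.ofReal (Real.exp H)) :
    (∫⁻ y, g y ∂μ) ^ P ≤
      (ENNReal.ofReal (2 ^ Q * Real.exp L) * (∫⁻ y, g y ^ (p y / q) ∂μ + 1)) ^ q := by
  have hq0 : 0 < q := by linarith
  have hL : 0 ≤ L := (mul_nonneg hε hH).trans hεH
  -- Where `g ≥ 1`, powers increase with the exponent, so `p y` may be lowered to a constant. The
  -- part with `g < 1` adds at most `1` to the average, which is one source of the `+ 1` in the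
  -- conclusion.
  set g1 : X → ℝ≥0∞ := fun y => (Ici 1 : Set ℝ≥0∞).indicator id (g y) with hg1
  have hg1m : AEMeasurable g1 μ :=
    (measurable_id.indicator measurableSet_Ici).comp_aemeasurable hg
  have hg1eq : ∀ y, 1 ≤ g y → g1 y = g y := fun y h => by simp [hg1, h]
  have hg1eq' : ∀ y, ¬ 1 ≤ g y → g1 y = 0 := fun y h => by simp [hg1, h]
  -- A constant lower bound for `p` that is within `ε` of `P`; ordinary Jensen applies with exponent
  -- `m / q`.
  set m := max q (P - ε) with hm
  have hqm : q ≤ m := le_max_left _ _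
  have hmP : m ≤ P := max_le hqP (by linarith)
  have hPm : P - m ≤ ε := by
    have := le_max_right q (P - ε)
    linarith
  have hm0 : 0 < m := by linarith
  set a := ∫⁻ y, g y ∂μ
  set A := ∫⁻ y, g y ^ (p y / q) ∂μ
  set a1 := ∫⁻ y, g1 y ∂μ
  set A1 := ∫⁻ y, g1 y ^ (m / q) ∂μ
  have ha : a ≤ a1 + 1 := by
    calc a ≤ ∫⁻ y, g1 y + 1 ∂μ := by
          refine lintegral_mono fun y => ?_
          by_cases h : 1 ≤ g y
          · rw [hg1eq y h]
            exact le_self_add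
          · exact (not_le.1 h).le.trans le_add_self
      _ = a1 + 1 := by rw [lintegral_add_right _ measurable_const]; simp [a1]
  have hA1A : A1 ≤ A := by
    refine lintegral_mono_ae ?_
    filter_upwards [hp] with y hy
    by_cases h : 1 ≤ g y
    · rw [hg1eq y h]
      exact ENNReal.rpow_le_rpow_of_exponent_le h
        (div_le_div_of_nonneg_right (max_le hy.1 hy.2) hq0.le)
    · rw [hg1eq' y h, ENNReal.zero_rpow_of_pos (by positivity)]
      exact zero_le
  have hA1H : A1 ≤ ENNReal.ofReal (Real.exp H) := by
    refine le_trans (lintegral_mono_ae ?_) hgp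
    filter_upwards [hp] with y hy
    by_cases h : 1 ≤ g y
    · rw [hg1eq y h]
      refine ENNReal.rpow_le_rpow_of_exponent_le h ?_
      exact (div_le_self hm0.le hq).trans (max_le hy.1 hy.2)
    · rw [hg1eq' y h, ENNReal.zero_rpow_of_pos (by positivity)]
      exact zero_le
  have hJ : a1 ^ (m / q) ≤ A1 := rpow_lintegral_le μ hg1m ((one_le_div hq0).2 hqm)
  have hθ0 : 0 ≤ (P - m) / m := div_nonneg (by linarith) hm0.le
  have hθ : (P - m) / m ≤ ε := (div_le_self (by linarith) (by linarith)).trans hPm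
  -- Passing from `m / q` to `P / q` costs the factor `A1 ^ ((P - m) / m)`, at most `exp (H * ε) ≤
  -- exp L` because `m ≥ 1` and `A1 ≤ exp H`.
  have hJ2 : a1 ^ (P / q) ≤ A * ENNReal.ofReal (Real.exp L) := by
    have e : P / q = m / q * (1 + (P - m) / m) := by
      field_simp
      ring
    rw [e, ENNReal.rpow_mul]
    calc (a1 ^ (m / q)) ^ (1 + (P - m) / m) ≤ A1 ^ (1 + (P - m) / m) := by gcongr
      _ = A1 * A1 ^ ((P - m) / m) := by
        rw [ENNReal.rpow_add_of_nonneg _ _ zero_le_one hθ0, ENNReal.rpow_one]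
      _ ≤ A * ENNReal.ofReal (Real.exp L) := by
        refine mul_le_mul' hA1A ?_
        calc A1 ^ ((P - m) / m) ≤ ENNReal.ofReal (Real.exp H) ^ ((P - m) / m) := by gcongr
          _ = ENNReal.ofReal (Real.exp (H * ((P - m) / m))) := by
            rw [ENNReal.ofReal_rpow_of_pos (Real.exp_pos _), ← Real.exp_mul]
          _ ≤ ENNReal.ofReal (Real.exp L) := by
            refine ENNReal.ofReal_le_ofReal (Real.exp_le_exp.2 (le_trans ?_ hεH))
            rw [mul_comm]
            gcongr
  have hPq : 1 ≤ P / q := (one_le_div hq0).2 hqP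
  have h1L : (1 : ℝ≥0∞) ≤ ENNReal.ofReal (Real.exp L) := by
    rw [ENNReal.one_le_ofReal]
    exact Real.one_le_exp hL
  have hmain : a ^ (P / q) ≤ ENNReal.ofReal (2 ^ Q * Real.exp L) * (A + 1) := by
    calc a ^ (P / q) ≤ (a1 + 1) ^ (P / q) := by gcongr
      _ ≤ 2 ^ (P / q - 1) * (a1 ^ (P / q) + 1 ^ (P / q)) :=
        ENNReal.rpow_add_le_mul_rpow_add_rpow _ _ hPq
      _ ≤ 2 ^ Q * (ENNReal.ofReal (Real.exp L) * (A + 1)) := by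
        refine mul_le_mul' (ENNReal.rpow_le_rpow_of_exponent_le (by norm_num) ?_) ?_
        · have := div_le_self (by linarith : 0 ≤ P) hq
          linarith
        · rw [ENNReal.one_rpow, mul_add, mul_one, mul_comm _ A]
          exact add_le_add hJ2 h1L
      _ = ENNReal.ofReal (2 ^ Q * Real.exp L) * (A + 1) := by
        rw [ENNReal.ofReal_mul (by positivity), ← ENNReal.ofReal_rpow_of_pos two_pos,
          ENNReal.ofReal_ofNat, mul_assoc]
  calc a ^ P = (a ^ (P / q)) ^ q := by
        rw [← ENNReal.rpow_mul, div_mul_cancel₀ _ hq0.ne']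
    _ ≤ _ := by gcongr

/-! ### Carleson-type embedding: from weak type to strong type -/

/-- The layer-cake formula for a Dirac mass; the case `A = ∞` follows from the finite one by
monotonicity in `A`. -/
lemma lintegral_rpow_sub_one_indicator (A : ℝ≥0∞) {s : ℝ} (hs : 0 < s) :
    ENNReal.ofReal s * ∫⁻ t in Ioi (0 : ℝ),
      {t : ℝ | ENNReal.ofReal t < A}.indicator (fun t => ENNReal.ofReal (t ^ (s - 1))) t =
        A ^ s := by
  have hfin : ∀ a : ℝ, 0 ≤ a → ENNReal.ofReal s * ∫⁻ t in Ioi (0 : ℝ),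
      {t : ℝ | ENNReal.ofReal t < ENNReal.ofReal a}.indicator
        (fun t => ENNReal.ofReal (t ^ (s - 1))) t = ENNReal.ofReal a ^ s := by
    intro a ha
    have h := lintegral_rpow_eq_lintegral_meas_lt_mul (Measure.dirac ()) (f := fun _ => a)
      (Filter.Eventually.of_forall fun _ => ha) aemeasurable_const hs
    rw [lintegral_dirac] at h
    rw [ENNReal.ofReal_rpow_of_nonneg ha hs.le, h]
    congr 1
    refine setLIntegral_congr_fun measurableSet_Ioi fun t ht => ?_
    by_cases hta : t < a
    · have : ENNReal.ofReal t < ENNReal.ofReal a :=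
        (ENNReal.ofReal_lt_ofReal_iff_of_nonneg (le_of_lt ht)).2 hta
      simp [indicator, this, hta]
    · have : ¬ ENNReal.ofReal t < ENNReal.ofReal a := fun h' =>
        hta ((ENNReal.ofReal_lt_ofReal_iff_of_nonneg (le_of_lt ht)).1 h')
      simp [indicator, this, hta]
  by_cases hA : A = ∞
  · subst hA
    rw [ENNReal.top_rpow_of_pos hs]
    refine ENNReal.eq_top_of_forall_nnreal_le ?_
    intro r
    have h1 : (r : ℝ≥0∞) = ENNReal.ofReal ((r : ℝ) ^ (1 / s)) ^ s := by
      rw [ENNReal.ofReal_rpow_of_nonneg (by positivity) hs.le, ← Real.rpow_mul r.coe_nonneg,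
        one_div_mul_cancel hs.ne', Real.rpow_one]
      simp
    rw [h1, ← hfin _ (by positivity)]
    gcongr
    exact le_top
  · rw [← ENNReal.ofReal_toReal hA]
    exact hfin _ ENNReal.toReal_nonneg

lemma measurableSet_ofReal_lt (A : ℝ≥0∞) : MeasurableSet {t : ℝ | ENNReal.ofReal t < A} :=
  measurableSet_lt ENNReal.measurable_ofReal measurable_const

/-- A weak-type bound for all levels implies the strong-type bound of exponent `q > 1`. -/
lemma lintegral_iSup_mul_rpow_le {ι X Y : Type*} [Countable ι] [MeasurableSpace X]
    [MeasurableSpace Y] {μ : Measure X} {ν : Measure Y} [SFinite μ] [SFinite ν]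
    {φ : ι → X → ℝ≥0∞} (hφ : ∀ i, AEMeasurable (φ i) μ) (A : ι → ℝ≥0∞)
    {G : Y → ℝ≥0∞} (hG : AEMeasurable G ν) {q : ℝ} (hq : 1 < q) {C : ℝ≥0∞} (hC : C ≠ ∞)
    (hweak : ∀ t : ℝ, 0 < t →
      ∫⁻ x, ⨆ i, {s : ℝ | ENNReal.ofReal s < A i}.indicator (fun _ => φ i x) t ∂μ ≤
        C * (ENNReal.ofReal t)⁻¹ * ∫⁻ y, {s : ℝ | ENNReal.ofReal s < 2 * G y}.indicator
          (fun _ => G y) t ∂ν) :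
    ∫⁻ x, ⨆ i, φ i x * A i ^ q ∂μ ≤
      C * ENNReal.ofReal q * (ENNReal.ofReal (q - 1))⁻¹ * ∫⁻ y, (2 * G y) ^ q ∂ν := by
  have hq0 : 0 < q := by linarith
  have hq1 : 0 < q - 1 := by linarith
  set τ : Measure ℝ := volume.restrict (Ioi (0 : ℝ)) with hτ
  set H : X → ℝ → ℝ≥0∞ := fun x t =>
    ⨆ i, {s : ℝ | ENNReal.ofReal s < A i}.indicator (fun _ => φ i x) t with hH
  have hpow : ∀ s : ℝ, Measurable fun t : ℝ => ENNReal.ofReal (t ^ s) := fun s =>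
    ENNReal.measurable_ofReal.comp (measurable_id.pow_const s)
  have hHm : AEMeasurable (Function.uncurry fun x t => ENNReal.ofReal (t ^ (q - 1)) * H x t)
      (μ.prod τ) := by
    refine AEMeasurable.mul ((hpow _).comp measurable_snd).aemeasurable ?_
    refine AEMeasurable.iSup fun i => ?_
    exact (hφ i).comp_fst.indicator (measurable_snd (measurableSet_ofReal_lt (A i)))
  -- Each `φ i x * A i ^ q` is a layer-cake integral over the levels `t < A i`; moving the supremum
  -- inside the integral only increases it.
  have h1 : ∀ x, ⨆ i, φ i x * A i ^ q ≤
      ENNReal.ofReal q * ∫⁻ t, ENNReal.ofReal (t ^ (q - 1)) * H x t ∂τ := by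
    intro x
    refine iSup_le fun i => ?_
    rw [← lintegral_rpow_sub_one_indicator (A i) hq0, mul_left_comm,
      ← lintegral_const_mul _ ((hpow _).indicator (measurableSet_ofReal_lt (A i)))]
    refine mul_le_mul_right (lintegral_mono fun t => ?_) _
    by_cases ht : ENNReal.ofReal t < A i
    · have h2 : φ i x ≤ H x t := by
        refine le_trans ?_ (le_iSup _ i)
        simp [indicator, ht]
      simp only [indicator, mem_ofPred_eq, ht, if_true]
      rw [mul_comm]
      gcongr
    · simp [indicator, ht]
  have hGm : AEMeasurable (Function.uncurry fun (t : ℝ) y => ENNReal.ofReal (t ^ (q - 1 - 1)) *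
      {s : ℝ | ENNReal.ofReal s < 2 * G y}.indicator (fun _ => G y) t) (τ.prod ν) := by
    refine AEMeasurable.mul ((hpow _).comp measurable_fst).aemeasurable ?_
    have h3 : NullMeasurableSet {z : ℝ × Y | ENNReal.ofReal z.1 < 2 * G z.2} (τ.prod ν) :=
      nullMeasurableSet_lt (ENNReal.measurable_ofReal.comp measurable_fst).aemeasurable
        (hG.comp_snd.const_mul 2)
    exact hG.comp_snd.indicator₀ h3
  calc ∫⁻ x, ⨆ i, φ i x * A i ^ q ∂μ
      ≤ ∫⁻ x, ENNReal.ofReal q * ∫⁻ t, ENNReal.ofReal (t ^ (q - 1)) * H x t ∂τ ∂μ :=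
        lintegral_mono h1
    _ = ENNReal.ofReal q * ∫⁻ t, ∫⁻ x, ENNReal.ofReal (t ^ (q - 1)) * H x t ∂μ ∂τ := by
        rw [lintegral_const_mul' _ _ ENNReal.ofReal_ne_top, lintegral_lintegral_swap hHm]
    _ ≤ ENNReal.ofReal q * ∫⁻ t, C * ∫⁻ y, ENNReal.ofReal (t ^ (q - 1 - 1)) *
          {s : ℝ | ENNReal.ofReal s < 2 * G y}.indicator (fun _ => G y) t ∂ν ∂τ := by
        refine mul_le_mul_right (setLIntegral_mono' measurableSet_Ioi fun t ht => ?_) _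
        have ht' : (0 : ℝ) < t := ht
        rw [lintegral_const_mul' _ _ ENNReal.ofReal_ne_top,
          lintegral_const_mul' _ _ ENNReal.ofReal_ne_top]
        refine (mul_le_mul_right (hweak t ht') _).trans_eq ?_
        rw [Real.rpow_sub_one ht'.ne' (q - 1), ENNReal.ofReal_div_of_pos ht', div_eq_mul_inv]
        ring
    _ = ENNReal.ofReal q * C * ∫⁻ y, ∫⁻ t, ENNReal.ofReal (t ^ (q - 1 - 1)) *
          {s : ℝ | ENNReal.ofReal s < 2 * G y}.indicator (fun _ => G y) t ∂τ ∂ν := by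
        rw [lintegral_const_mul' _ _ hC, lintegral_lintegral_swap hGm, mul_assoc]
    _ ≤ ENNReal.ofReal q * C * ∫⁻ y, (ENNReal.ofReal (q - 1))⁻¹ * (2 * G y) ^ q ∂ν := by
        refine mul_le_mul_right (lintegral_mono fun y => ?_) _
        -- The level integral is `∫_0^{2G} t^(q-2) dt = (2G)^(q-1) / (q-1)`, where `q > 1` is
        -- essential. The remaining factor `G` is then enlarged to `2G`.
        have h4 : ∀ t : ℝ, ENNReal.ofReal (t ^ (q - 1 - 1)) *
            {s : ℝ | ENNReal.ofReal s < 2 * G y}.indicator (fun _ => G y) t =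
            G y * {s : ℝ | ENNReal.ofReal s < 2 * G y}.indicator
              (fun t => ENNReal.ofReal (t ^ (q - 1 - 1))) t := by
          intro t
          by_cases ht : ENNReal.ofReal t < 2 * G y
          · simp [indicator, mul_comm]
          · simp [indicator, ht]
        have h5 := lintegral_rpow_sub_one_indicator (2 * G y) hq1
        simp only [h4]
        rw [lintegral_const_mul _ ((hpow _).indicator (measurableSet_ofReal_lt _))]
        have hne : ENNReal.ofReal (q - 1) ≠ 0 := by simpa using hq
        have h6 : (∫⁻ t, {s : ℝ | ENNReal.ofReal s < 2 * G y}.indicator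
              (fun t => ENNReal.ofReal (t ^ (q - 1 - 1))) t ∂τ) =
            (ENNReal.ofReal (q - 1))⁻¹ * (2 * G y) ^ (q - 1) := by
          rw [← h5, ← mul_assoc, ENNReal.inv_mul_cancel hne ENNReal.ofReal_ne_top, one_mul]
        rw [h6, mul_left_comm]
        gcongr
        calc G y * (2 * G y) ^ (q - 1) ≤ (2 * G y) ^ (1 : ℝ) * (2 * G y) ^ (q - 1) := by
              rw [ENNReal.rpow_one]
              gcongr
              exact le_mul_of_one_le_left' (by norm_num)
          _ = (2 * G y) ^ q := by
              rw [← ENNReal.rpow_add_of_nonneg _ _ zero_le_one hq1.le]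
              congr 1
              ring
    _ = _ := by
        have hne : ENNReal.ofReal (q - 1) ≠ 0 := by simpa using hq
        rw [lintegral_const_mul' _ _ (ENNReal.inv_ne_top.2 hne)]
        ring

/-- The weak-type bound: testing on the enlargements `K i` controls the sup over all intervals
on which the average of `G` is large. -/
lemma lintegral_iSup_indicator_le {ι X : Type*} [Countable ι] [MeasurableSpace X]
    {μ ν : Measure X} [IsFiniteMeasure ν] {B K : ι → Set X} {δ : ι → ℝ} {R : ℝ}
    (hBm : ∀ i, MeasurableSet (B i)) (hBne : ∀ i, (B i).Nonempty)
    (hδ0 : ∀ i, 0 ≤ δ i) (hδR : ∀ i, δ i ≤ R)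
    (hBK : ∀ i j, (B j ∩ B i).Nonempty → δ j ≤ 2 * δ i → B j ⊆ K i)
    {φ : ι → X → ℝ≥0∞} (hφ : ∀ i, AEMeasurable (φ i) μ) {c D : ℝ≥0∞}
    (htest : ∀ i, ∫⁻ x, ⨆ j, ⨆ (_ : B j ⊆ K i), φ j x ∂μ ≤ c * ν (K i))
    (hν : ∀ i, ν (K i) ≤ D * ν (B i)) {G : X → ℝ≥0∞}
    {t : ℝ} (ht : 0 < t) :
    ∫⁻ x, ⨆ i, {s : ℝ | ENNReal.ofReal s < (∫⁻ y in B i, G y ∂ν) / ν (B i)}.indicator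
        (fun _ => φ i x) t ∂μ ≤
      c * D * 2 * (ENNReal.ofReal t)⁻¹ *
        ∫⁻ y, {s : ℝ | ENNReal.ofReal s < 2 * G y}.indicator (fun _ => G y) t ∂ν := by
  have ht0 : ENNReal.ofReal t ≠ 0 := by simpa using ht
  set T : Set ι := {i | ENNReal.ofReal t < (∫⁻ y in B i, G y ∂ν) / ν (B i)} with hT
  -- Vitali: the selected `B i` are disjoint, and every `B j` with average above `t` meets a
  -- selected `B i` with `δ j ≤ 2 * δ i`, so it lies in `K i`.
  obtain ⟨u, huT, hdisj, hcov⟩ := Vitali.exists_disjoint_subfamily_covering_enlargement B T δ 2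
    one_lt_two (fun i _ => hδ0 i) R (fun i _ => hδR i) (fun i _ => hBne i)
  set E : X → ℝ≥0∞ := fun y => {s : ℝ | ENNReal.ofReal s < 2 * G y}.indicator (fun _ => G y) t
  -- Values `G ≤ t / 2` account for at most half of `t * ν (B i)`. As `ν` is finite, this half can
  -- be subtracted, leaving only the part of `G` above `t / 2`.
  have hsmall : ∀ i ∈ T, ν (B i) ≤ 2 * (ENNReal.ofReal t)⁻¹ * ∫⁻ y in B i, E y ∂ν := by
    intro i hi
    have hi' : ENNReal.ofReal t * ν (B i) ≤ ∫⁻ y in B i, G y ∂ν :=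
      ENNReal.mul_le_of_le_div (le_of_lt hi)
    have hle : ∫⁻ y in B i, G y ∂ν ≤ ∫⁻ y in B i, E y ∂ν + ENNReal.ofReal t / 2 * ν (B i) := by
      have h1 : ∀ y, G y ≤ E y + ENNReal.ofReal t / 2 := by
        intro y
        by_cases hy : ENNReal.ofReal t < 2 * G y
        · simp [E, indicator, hy]
        · refine le_trans ?_ le_add_self
          rw [ENNReal.le_div_iff_mul_le (by simp) (by simp), mul_comm]
          exact not_lt.1 hy
      refine (lintegral_mono h1).trans_eq ?_
      rw [lintegral_add_right _ measurable_const]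
      simp
    have hfin : ENNReal.ofReal t / 2 * ν (B i) ≠ ∞ :=
      ENNReal.mul_ne_top (ENNReal.div_ne_top ENNReal.ofReal_ne_top (by simp)) (measure_ne_top _ _)
    have h2 : ENNReal.ofReal t / 2 * ν (B i) ≤ ∫⁻ y in B i, E y ∂ν := by
      have h3 := hi'.trans hle
      rw [← ENNReal.add_halves (ENNReal.ofReal t), add_mul, ENNReal.add_halves] at h3
      exact (ENNReal.add_le_add_iff_right hfin).1 h3
    calc ν (B i) = 2 * (ENNReal.ofReal t)⁻¹ * (ENNReal.ofReal t / 2 * ν (B i)) := by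
          have : 2 * (ENNReal.ofReal t)⁻¹ * (ENNReal.ofReal t / 2 * ν (B i)) =
              (2 * 2⁻¹) * ((ENNReal.ofReal t)⁻¹ * ENNReal.ofReal t) * ν (B i) := by
            rw [div_eq_mul_inv]
            ring
          rw [this, ENNReal.mul_inv_cancel (by simp) (by simp),
            ENNReal.inv_mul_cancel ht0 ENNReal.ofReal_ne_top, one_mul, one_mul]
      _ ≤ _ := mul_le_mul_right h2 _
  have hpt : ∀ x, ⨆ i, {s : ℝ | ENNReal.ofReal s < (∫⁻ y in B i, G y ∂ν) / ν (B i)}.indicator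
      (fun _ => φ i x) t ≤ ∑' i : u, ⨆ j, ⨆ (_ : B j ⊆ K i), φ j x := by
    intro x
    refine iSup_le fun j => ?_
    by_cases hj : j ∈ T
    · obtain ⟨i, hi, hne, hδ⟩ := hcov j hj
      refine le_trans ?_ (ENNReal.le_tsum (⟨i, hi⟩ : u))
      refine le_trans ?_ (le_iSup₂_of_le j (hBK i j hne hδ) le_rfl)
      exact indicator_le_self' (fun _ _ => zero_le) _
    · have : t ∉ {s : ℝ | ENNReal.ofReal s < (∫⁻ y in B j, G y ∂ν) / ν (B j)} := hj
      rw [indicator_of_notMem this]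
      exact zero_le
  calc _ ≤ ∫⁻ x, ∑' i : u, ⨆ j, ⨆ (_ : B j ⊆ K i), φ j x ∂μ := lintegral_mono hpt
    _ = ∑' i : u, ∫⁻ x, ⨆ j, ⨆ (_ : B j ⊆ K i), φ j x ∂μ :=
        lintegral_tsum fun i => AEMeasurable.iSup fun j => AEMeasurable.iSup fun _ => hφ j
    _ ≤ ∑' i : u, c * (D * (2 * (ENNReal.ofReal t)⁻¹ * ∫⁻ y in B i, E y ∂ν)) := by
        refine ENNReal.tsum_le_tsum fun i => (htest i).trans ?_
        gcongr
        refine (hν i).trans ?_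
        gcongr
        exact hsmall i (huT i.2)
    _ = c * D * 2 * (ENNReal.ofReal t)⁻¹ * ∑' i : u, ∫⁻ y in B i, E y ∂ν := by
        rw [← ENNReal.tsum_mul_left]
        congr with i
        ring
    _ ≤ c * D * 2 * (ENNReal.ofReal t)⁻¹ * ∫⁻ y, E y ∂ν := by
        gcongr
        rw [← lintegral_iUnion (fun i : u => hBm i) hdisj.subtype E]
        exact setLIntegral_le_lintegral _ _

/-! ### The dual weight, the Luxemburg norm and the maximal function -/

/-- The exponents satisfy `p - p p' = -p'`, so `w^p σ^p = σ`. This converts the modular of `w g σ`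
into that of `g` with respect to `σ dx`. -/
lemma ofReal_mul_dualWeight_rpow {p w : ℝ → ℝ} {x : ℝ} (hp : 1 < p x) (hw : 0 < w x)
    (g : ℝ≥0∞) :
    (ENNReal.ofReal (w x) * (g * dualWeight p w x)) ^ p x = g ^ p x * dualWeight p w x := by
  have hp0 : 0 ≤ p x := by linarith
  have hW0 : ENNReal.ofReal (w x) ≠ 0 := by simpa using hw
  have hne : p x - 1 ≠ 0 := by linarith
  rw [mul_left_comm, ENNReal.mul_rpow_of_nonneg _ _ hp0]
  congr 1
  rw [dualWeight, ENNReal.mul_rpow_of_nonneg _ _ hp0, ← ENNReal.rpow_mul,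
    ← ENNReal.rpow_add _ _ hW0 ENNReal.ofReal_ne_top]
  congr 1
  rw [conjExp]
  field_simp
  ring

lemma dualWeight_ne_zero {p w : ℝ → ℝ} {x : ℝ} (hw : 0 < w x) : dualWeight p w x ≠ 0 := by
  simp [dualWeight, ENNReal.rpow_eq_zero_iff, not_le.2 hw]

lemma dualWeight_ne_top {p w : ℝ → ℝ} {x : ℝ} (hw : 0 < w x) : dualWeight p w x ≠ ∞ := by
  simp [dualWeight, ENNReal.rpow_eq_top_iff, not_le.2 hw]

lemma aemeasurable_dualWeight {μ : Measure ℝ} {p w : ℝ → ℝ} (hp : AEMeasurable p μ)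
    (hw : AEMeasurable w μ) : AEMeasurable (dualWeight p w) μ :=
  hw.ennreal_ofReal.pow (hp.div (hp.sub_const 1)).neg

lemma le_fracMaximal {J I : Set ℝ} {α : ℝ} {g : ℝ → ℝ≥0∞} {x : ℝ} (hI : I.OrdConnected)
    (hx : x ∈ I) (hIJ : I ⊆ J) :
    (∫⁻ y in I, g y) / volume I ^ (1 - α) ≤ fracMaximal J α g x :=
  le_iSup₂_of_le I hI (le_iSup₂_of_le hx hIJ le_rfl)

lemma fracMaximal_congr_ae {J : Set ℝ} {α : ℝ} {g h : ℝ → ℝ≥0∞}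
    (hgh : g =ᵐ[volume.restrict J] h) : fracMaximal J α g = fracMaximal J α h := by
  funext x
  refine iSup_congr fun I => iSup_congr fun _ => iSup_congr fun _ => iSup_congr fun hIJ => ?_
  rw [lintegral_congr_ae (ae_restrict_of_ae_restrict_of_subset hIJ hgh)]

lemma lpNorm_le {J : Set ℝ} {p : ℝ → ℝ} {g : ℝ → ℝ≥0∞} {l : ℝ≥0} (hl : 0 < l)
    (h : modular J p (fun x => g x / (l : ℝ≥0∞)) ≤ 1) : lpNorm J p g ≤ l :=
  iInf_le_of_le l (iInf₂_le_of_le hl h le_rfl)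

lemma modular_div_le_one {J : Set ℝ} (hJ : MeasurableSet J) {p : ℝ → ℝ} (hp : ∀ x ∈ J, 0 ≤ p x)
    {g : ℝ → ℝ≥0∞} {l : ℝ≥0∞} (h : lpNorm J p g < l) : modular J p (fun x => g x / l) ≤ 1 := by
  simp only [lpNorm, iInf_lt_iff] at h
  obtain ⟨k, hk, hmod, hkl⟩ := h
  refine le_trans (setLIntegral_mono' hJ fun x hx => ?_) hmod
  exact ENNReal.rpow_le_rpow (ENNReal.div_le_div_left hkl.le _) (hp x hx)

/-! ### Necessity of the testing condition -/

/-- The two-weight norm inequality in modular form. -/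
lemma modular_fracMaximal_le_one {J : Set ℝ} (hJ : MeasurableSet J) {p : ℝ → ℝ}
    (hp : ∀ x ∈ J, 0 ≤ p x) {α : ℝ} {v w : ℝ → ℝ} {c : ℝ} (hc : 0 < c)
    (h : ∀ f : ℝ → ℝ, AEMeasurable f (volume.restrict J) →
      lpNorm J p (fun x => ENNReal.ofReal (v x) * fracMaximal J α (fun y => ‖f y‖ₑ) x) ≤
        ENNReal.ofReal c * lpNorm J p (fun x => ENNReal.ofReal (w x) * ‖f x‖ₑ))
    {f : ℝ → ℝ≥0∞} (hf : AEMeasurable f (volume.restrict J))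
    (hfin : ∀ᵐ x ∂volume.restrict J, f x ≠ ∞) {l : ℝ} (hl : 0 < l)
    (hmod : modular J p (fun x => ENNReal.ofReal (w x) * f x / ENNReal.ofReal l) ≤ 1) :
    modular J p (fun x => ENNReal.ofReal (v x) * fracMaximal J α f x /
      ENNReal.ofReal (2 * c * l)) ≤ 1 := by
  have hae : (fun y => ‖(f y).toReal‖ₑ) =ᵐ[volume.restrict J] f := by
    filter_upwards [hfin] with y hy
    rw [Real.enorm_of_nonneg ENNReal.toReal_nonneg, ENNReal.ofReal_toReal hy]
  have h1 := h (fun y => (f y).toReal) hf.ennreal_toReal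
  rw [fracMaximal_congr_ae hae] at h1
  -- A strict inequality is required, because the infimum defining the norm is not known to be
  -- attained; the factor `2` supplies it.
  refine modular_div_le_one hJ hp (h1.trans_lt ?_)
  have h2 : lpNorm J p (fun x => ENNReal.ofReal (w x) * ‖(f x).toReal‖ₑ) ≤ ENNReal.ofReal l := by
    refine lpNorm_le (l := l.toNNReal) (by simpa using hl) ((le_of_eq ?_).trans hmod)
    refine lintegral_congr_ae ?_
    filter_upwards [hae] with y hy
    simp only [hy]
    rfl
  calc _ ≤ ENNReal.ofReal c * ENNReal.ofReal l := by gcongr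
    _ = ENNReal.ofReal (c * l) := (ENNReal.ofReal_mul hc.le).symm
    _ < ENNReal.ofReal (2 * c * l) := by
      rw [ENNReal.ofReal_lt_ofReal_iff (by positivity)]
      nlinarith [mul_pos hc hl]

/-- Under the two-weight inequality the dual weight is integrable over `J`. -/
lemma TwoWeightInequality.lintegral_dualWeight_lt_top {J : Set ℝ} (hJ : J.OrdConnected)
    (hJb : Bornology.IsBounded J) {p : ℝ → ℝ} {pminus pplus : ℝ} (hpminus : 1 < pminus)
    (hp : ∀ x ∈ J, pminus ≤ p x ∧ p x ≤ pplus) (hpm : AEMeasurable p (volume.restrict J))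
    {α : ℝ} {v w : ℝ → ℝ}
    (hvm : AEMeasurable v (volume.restrict J)) (hwm : AEMeasurable w (volume.restrict J))
    (hv : ∀ᵐ x ∂volume.restrict J, 0 ≤ v x) (hv0 : ¬ ∀ᵐ x ∂volume.restrict J, v x = 0)
    (hw : ∀ᵐ x ∂volume.restrict J, 0 < w x) (h : TwoWeightInequality J p α v w) :
    ∫⁻ x in J, dualWeight p w x < ∞ := by
  obtain ⟨c, hc, h⟩ := h
  have hJm := hJ.measurableSet
  have hp0 : ∀ x ∈ J, 0 ≤ p x := fun x hx => by linarith [hp x hx]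
  have hσm := aemeasurable_dualWeight hpm hwm
  have hvol0 : volume J ≠ 0 := by
    intro h0
    refine hv0 ?_
    rw [Measure.restrict_eq_zero.2 h0, ae_zero]
    exact Filter.eventually_bot
  have hvolT : volume J ≠ ∞ := volume_ne_top_of_bounded hJb
  set m := (volume J).toReal with hm
  have hm0 : 0 < m := ENNReal.toReal_pos hvol0 hvolT
  set V := ∫⁻ x in J, ENNReal.ofReal (v x) ^ p x with hV
  have hV0 : V ≠ 0 := by
    intro h0
    rw [hV, lintegral_eq_zero_iff' (hvm.ennreal_ofReal.pow hpm)] at h0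
    refine hv0 ?_
    filter_upwards [h0, hv, ae_restrict_mem hJm] with x hx hvx hxJ
    have hpx : 0 < p x := by linarith [hp x hxJ]
    have : ENNReal.ofReal (v x) = 0 := (ENNReal.rpow_eq_zero_iff_of_pos hpx).1 hx
    exact le_antisymm (ENNReal.ofReal_eq_zero.1 this) hvx
  set θ := 1 - pminus⁻¹ with hθ
  have hθ0 : 0 < θ := by
    rw [hθ, sub_pos]
    exact inv_lt_one_of_one_lt₀ hpminus
  set A := max 1 V⁻¹.toReal with hA
  set B := (A * (m ^ (1 - α) * (2 * c))) ^ θ⁻¹ with hB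
  -- Truncation makes the integrals finite, so one can divide by them; the bound is uniform in `k`,
  -- and monotone convergence concludes.
  suffices hk : ∀ k : ℕ, ∫⁻ x in J, min (dualWeight p w x) k ≤ ENNReal.ofReal (max 1 B) by
    have hsup : ∀ x, dualWeight p w x = ⨆ k : ℕ, min (dualWeight p w x) k := fun x => by
      rw [← inf_iSup_eq, ENNReal.iSup_natCast, inf_top_eq]
    rw [lintegral_congr hsup, lintegral_iSup' (fun k => hσm.min aemeasurable_const)
      (Filter.Eventually.of_forall fun x i j hij => by
        dsimp only
        gcongr)]
    exact (iSup_le hk).trans_lt ENNReal.ofReal_lt_top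
  intro k
  set S := ∫⁻ x in J, min (dualWeight p w x) k with hS
  have hST : S ≠ ∞ := by
    refine ne_top_of_le_ne_top (ENNReal.mul_ne_top (ENNReal.natCast_ne_top k) hvolT)
      ((lintegral_mono fun x => min_le_right _ _).trans_eq ?_)
    simp
  rw [← ENNReal.ofReal_toReal hST]
  set s := S.toReal with hs
  refine ENNReal.ofReal_le_ofReal ?_
  by_cases hs1 : s ≤ 1
  · exact hs1.trans (le_max_left _ _)
  have hs1' : 1 < s := not_le.1 hs1
  have hs0 : 0 < s := by linarith
  refine le_trans ?_ (le_max_right _ _)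
  -- For `s > 1` this gives `l ^ p x ≥ s` throughout `J`, hence a modular at most `1`.
  set l := s ^ pminus⁻¹ with hl
  have hl0 : 0 < l := Real.rpow_pos_of_pos hs0 _
  have hl1 : 1 ≤ l := Real.one_le_rpow hs1'.le (by positivity)
  have hlp : ∀ x ∈ J, s ≤ l ^ p x := by
    intro x hx
    calc s = l ^ pminus := by
          rw [hl, ← Real.rpow_mul hs0.le, inv_mul_cancel₀ (by linarith), Real.rpow_one]
      _ ≤ l ^ p x := Real.rpow_le_rpow_of_exponent_le hl1 (hp x hx).1
  have hSs : S = ENNReal.ofReal s := (ENNReal.ofReal_toReal hST).symm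
  have hS0 : S ≠ 0 := by
    rw [hSs]
    simpa using hs0
  have hmod : modular J p (fun x => ENNReal.ofReal (w x) * min (dualWeight p w x) k /
      ENNReal.ofReal l) ≤ 1 := by
    calc _ ≤ ∫⁻ x in J, min (dualWeight p w x) k * S⁻¹ := by
          refine lintegral_mono_ae ?_
          filter_upwards [hw, ae_restrict_mem hJm] with x hwx hxJ
          have hσ0 := dualWeight_ne_zero (p := p) hwx
          have hσT := dualWeight_ne_top (p := p) hwx
          have hpx : 1 < p x := by linarith [hp x hxJ]
          set g := min (dualWeight p w x) k / dualWeight p w x with hg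
          have hg1 : g ≤ 1 := ENNReal.div_le_of_le_mul (by simp)
          have hgσ : min (dualWeight p w x) k = g * dualWeight p w x :=
            (ENNReal.div_mul_cancel hσ0 hσT).symm
          rw [hgσ, ENNReal.div_rpow_of_nonneg _ _ (hp0 x hxJ), ofReal_mul_dualWeight_rpow hpx hwx,
            ENNReal.ofReal_rpow_of_pos hl0, div_eq_mul_inv, hSs]
          gcongr
          · calc g ^ p x ≤ g ^ (1 : ℝ) := ENNReal.rpow_le_rpow_of_exponent_ge hg1 hpx.le
              _ = g := ENNReal.rpow_one g
          · exact hlp x hxJ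
      _ = 1 := by
        rw [lintegral_mul_const' _ _ (ENNReal.inv_ne_top.2 hS0), ENNReal.mul_inv_cancel hS0 hST]
  have hmod2 := modular_fracMaximal_le_one hJm hp0 hc h
    (hσm.min (aemeasurable_const (b := (k : ℝ≥0∞))))
    (Filter.Eventually.of_forall fun x =>
      ne_top_of_le_ne_top (ENNReal.natCast_ne_top k) (min_le_right _ _)) hl0 hmod
  -- Using `J` itself in the supremum, the maximal function of the truncation divided by `2 * c * l`
  -- is at least `a` on `J`. If `a > 1`, then `a * V ≤ 1`, so `a`, and with it `s`, is bounded
  -- independently of `k`.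
  set a := s ^ θ / (m ^ (1 - α) * (2 * c)) with ha
  have hd0 : 0 < m ^ (1 - α) * (2 * c) := mul_pos (Real.rpow_pos_of_pos hm0 _) (by linarith)
  have haA : a ≤ A := by
    by_cases ha1 : a ≤ 1
    · exact ha1.trans (le_max_left _ _)
    have ha1' : 1 < a := not_le.1 ha1
    refine le_trans ?_ (le_max_right _ _)
    have haV : ENNReal.ofReal a * V ≤ 1 := by
      refine le_trans ?_ hmod2
      rw [hV, ← lintegral_const_mul' _ _ ENNReal.ofReal_ne_top]
      refine setLIntegral_mono' hJm fun x hx => ?_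
      have hpx : 1 ≤ p x := by linarith [hp x hx]
      have hae : ENNReal.ofReal a * ENNReal.ofReal (2 * c * l) =
          S / volume J ^ (1 - α) := by
        have e1 : volume J ^ (1 - α) = ENNReal.ofReal (m ^ (1 - α)) := by
          rw [← ENNReal.ofReal_rpow_of_pos hm0, hm, ENNReal.ofReal_toReal hvolT]
        rw [e1, hSs, ← ENNReal.ofReal_div_of_pos (Real.rpow_pos_of_pos hm0 _),
          ← ENNReal.ofReal_mul (by linarith)]
        congr 1
        have e2 : s ^ θ * l = s := by
          rw [hl, hθ, ← Real.rpow_add hs0, sub_add_cancel, Real.rpow_one]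
        have e3 : m ^ (1 - α) ≠ 0 := (Real.rpow_pos_of_pos hm0 _).ne'
        rw [ha]
        field_simp
        exact e2
      have hM : ENNReal.ofReal a * ENNReal.ofReal (2 * c * l) ≤
          fracMaximal J α (fun x => min (dualWeight p w x) k) x := by
        rw [hae]
        exact le_fracMaximal hJ hx le_rfl
      calc ENNReal.ofReal a * ENNReal.ofReal (v x) ^ p x
          ≤ ENNReal.ofReal a ^ p x * ENNReal.ofReal (v x) ^ p x := by
            gcongr
            calc ENNReal.ofReal a = ENNReal.ofReal a ^ (1 : ℝ) := (ENNReal.rpow_one _).symm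
              _ ≤ ENNReal.ofReal a ^ p x := by
                refine ENNReal.rpow_le_rpow_of_exponent_le ?_ hpx
                rw [ENNReal.one_le_ofReal]
                exact ha1'.le
        _ = (ENNReal.ofReal (v x) * ENNReal.ofReal a) ^ p x := by
            rw [ENNReal.mul_rpow_of_nonneg _ _ (hp0 x hx), mul_comm]
        _ ≤ _ := by
            refine ENNReal.rpow_le_rpow ?_ (hp0 x hx)
            rw [ENNReal.le_div_iff_mul_le
              (Or.inl (by simpa using by positivity)) (Or.inl ENNReal.ofReal_ne_top), mul_assoc]
            gcongr
    have hVT : V ≠ ∞ := by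
      intro hVT
      rw [hVT, ENNReal.mul_top (by simpa using by linarith)] at haV
      simp at haV
    rw [← ENNReal.ofReal_le_iff_le_toReal (ENNReal.inv_ne_top.2 hV0)]
    exact ENNReal.le_inv_iff_mul_le.2 haV
  have hsθ : s ^ θ ≤ A * (m ^ (1 - α) * (2 * c)) := (div_le_iff₀ hd0).1 haA
  calc s = (s ^ θ) ^ θ⁻¹ := by rw [← Real.rpow_mul hs0.le, mul_inv_cancel₀ hθ0.ne', Real.rpow_one]
    _ ≤ B := Real.rpow_le_rpow (by positivity) hsθ (by positivity)

/-- Under the two-weight inequality the testing inequality holds on every interval of positive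
length, provided the dual weight is integrable and satisfies the oscillation bound. -/
lemma lintegral_testing_le {J : Set ℝ} (hJm : MeasurableSet J) {p : ℝ → ℝ} {pplus : ℝ}
    (hp : ∀ x ∈ J, 1 < p x ∧ p x ≤ pplus) (hpm : AEMeasurable p (volume.restrict J))
    {α : ℝ} {v w : ℝ → ℝ} (hwm : AEMeasurable w (volume.restrict J))
    (hw : ∀ᵐ x ∂volume.restrict J, 0 < w x) {c : ℝ} (hc : 0 < c)
    (h : ∀ f : ℝ → ℝ, AEMeasurable f (volume.restrict J) →
      lpNorm J p (fun x => ENNReal.ofReal (v x) * fracMaximal J α (fun y => ‖f y‖ₑ) x) ≤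
        ENNReal.ofReal c * lpNorm J p (fun x => ENNReal.ofReal (w x) * ‖f x‖ₑ))
    {I : Set ℝ} (hI : I.OrdConnected) (hIJ : I ⊆ J) {x₀ : ℝ} (hx₀ : x₀ ∈ I)
    (hS0 : ∫⁻ x in I, dualWeight p w x ≠ 0) (hST : ∫⁻ x in I, dualWeight p w x ≠ ∞)
    {ε L : ℝ} (hL : 0 ≤ L) (hε : ∀ x ∈ I, ∀ y ∈ I, |p x - p y| ≤ ε)
    (hεL : ε * |Real.log (∫⁻ x in I, dualWeight p w x).toReal| ≤ L) :
    ∫⁻ x in I, ENNReal.ofReal (v x) ^ p x *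
        fracMaximal J α (I.indicator (dualWeight p w)) x ^ p x ≤
      ENNReal.ofReal (max 1 (2 * c) ^ pplus * Real.exp (L * (pplus + 1))) *
        ∫⁻ x in I, dualWeight p w x := by
  have hIm := hI.measurableSet
  have hp0 : ∀ x ∈ J, 0 ≤ p x := fun x hx => by linarith [hp x hx]
  set S := ∫⁻ x in I, dualWeight p w x with hS
  set s := S.toReal with hs
  have hs0 : 0 < s := ENNReal.toReal_pos hS0 hST
  have hSs : S = ENNReal.ofReal s := (ENNReal.ofReal_toReal hST).symm
  have hp₀ := hp x₀ (hIJ hx₀)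
  -- Up to constants this is the norm of `w σ χ_I`. The factor `exp L` absorbs the oscillation of
  -- `p`, so that `l ^ p x` lies between `s` and a constant multiple of `s` on all of `I`.
  set l := Real.exp L * s ^ (p x₀)⁻¹ with hl
  have hl0 : 0 < l := by positivity
  have hlp : ∀ x ∈ I, s ≤ l ^ p x ∧ l ^ p x ≤ Real.exp (L * (pplus + 1)) * s := by
    intro x hx
    have hpx := hp x (hIJ hx)
    have hp₀ne : p x₀ ≠ 0 := by linarith
    have e1 : l ^ p x = Real.exp (L * p x + Real.log s * ((p x - p x₀) / p x₀)) * s := by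
      rw [hl, Real.mul_rpow (Real.exp_pos _).le (by positivity), ← Real.exp_mul,
        ← Real.rpow_mul hs0.le, Real.rpow_def_of_pos hs0]
      nth_rewrite 3 [← Real.exp_log hs0]
      rw [← Real.exp_add, ← Real.exp_add]
      congr 1
      field_simp
      ring
    have e2 : |Real.log s * ((p x - p x₀) / p x₀)| ≤ L := by
      rw [abs_mul, mul_comm]
      refine le_trans ?_ hεL
      gcongr
      rw [abs_div, abs_of_pos (by linarith : 0 < p x₀)]
      exact (div_le_self (abs_nonneg _) hp₀.1.le).trans (hε x hx x₀ hx₀)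
    have e3 := abs_le.1 e2
    rw [e1]
    constructor
    · refine le_mul_of_one_le_left hs0.le (Real.one_le_exp ?_)
      nlinarith
    · gcongr
      nlinarith
  have hσm := aemeasurable_dualWeight hpm hwm
  have hmod : modular J p (fun x => ENNReal.ofReal (w x) * I.indicator (dualWeight p w) x /
      ENNReal.ofReal l) ≤ 1 := by
    calc _ ≤ ∫⁻ x in J, I.indicator (fun x => dualWeight p w x * S⁻¹) x := by
          refine lintegral_mono_ae ?_
          filter_upwards [hw, ae_restrict_mem hJm] with x hwx hxJ
          have hpx := (hp x hxJ).1
          by_cases hxI : x ∈ I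
          · rw [indicator_of_mem hxI, indicator_of_mem hxI, ← one_mul (dualWeight p w x),
              ENNReal.div_rpow_of_nonneg _ _ (hp0 x hxJ), ofReal_mul_dualWeight_rpow hpx hwx,
              ENNReal.one_rpow, one_mul, ENNReal.ofReal_rpow_of_pos hl0, div_eq_mul_inv, hSs]
            gcongr
            exact (hlp x hxI).1
          · rw [indicator_of_notMem hxI, mul_zero, ENNReal.zero_div,
              ENNReal.zero_rpow_of_pos (by linarith)]
            exact zero_le
      _ = 1 := by
        rw [setLIntegral_indicator hIm, inter_eq_self_of_subset_left hIJ,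
          lintegral_mul_const' _ _ (ENNReal.inv_ne_top.2 hS0), ENNReal.mul_inv_cancel hS0 hST]
  have hfin : ∀ᵐ x ∂volume.restrict J, I.indicator (dualWeight p w) x ≠ ∞ := by
    filter_upwards [hw] with x hwx
    exact ne_top_of_le_ne_top (dualWeight_ne_top hwx) (indicator_le_self' (fun _ _ => zero_le) _)
  have hmod2 := modular_fracMaximal_le_one hJm hp0 hc h (hσm.indicator hIm) hfin hl0 hmod
  set C := max 1 (2 * c) ^ pplus * Real.exp (L * (pplus + 1)) with hC
  have hC0 : 0 < C := by positivity
  have hD0 : ENNReal.ofReal C * S ≠ 0 := mul_ne_zero (by simpa using hC0) hS0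
  have hDT : ENNReal.ofReal C * S ≠ ∞ := ENNReal.mul_ne_top ENNReal.ofReal_ne_top hST
  have hle : (∫⁻ x in I, ENNReal.ofReal (v x) ^ p x *
      fracMaximal J α (I.indicator (dualWeight p w)) x ^ p x) * (ENNReal.ofReal C * S)⁻¹ ≤ 1 := by
    rw [← lintegral_mul_const' _ _ (ENNReal.inv_ne_top.2 hD0)]
    refine le_trans (le_trans (setLIntegral_mono' hIm fun x hx => ?_) (lintegral_mono_set hIJ))
      hmod2
    have hpx := hp x (hIJ hx)
    have hpx0 := hp0 x (hIJ hx)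
    rw [ENNReal.div_rpow_of_nonneg _ _ hpx0, ENNReal.mul_rpow_of_nonneg _ _ hpx0, div_eq_mul_inv,
      ENNReal.ofReal_rpow_of_pos (mul_pos (mul_pos two_pos hc) hl0), hSs, ← ENNReal.ofReal_mul hC0.le]
    gcongr
    rw [Real.mul_rpow (by positivity) hl0.le, hC, mul_assoc]
    refine mul_le_mul ?_ (hlp x hx).2 (by positivity) (by positivity)
    calc (2 * c) ^ p x ≤ max 1 (2 * c) ^ p x := by
          gcongr
          exact le_max_right _ _
      _ ≤ max 1 (2 * c) ^ pplus := Real.rpow_le_rpow_of_exponent_le (le_max_left _ _) hpx.2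
  rwa [← div_eq_mul_inv, ENNReal.div_le_iff hD0 hDT, one_mul] at hle

lemma setLIntegral_dualWeight_ne_zero {J : Set ℝ} {p w : ℝ → ℝ}
    (hpm : AEMeasurable p (volume.restrict J)) (hwm : AEMeasurable w (volume.restrict J))
    (hw : ∀ᵐ x ∂volume.restrict J, 0 < w x) {I : Set ℝ} (hIJ : I ⊆ J) (hvol : volume I ≠ 0) :
    ∫⁻ x in I, dualWeight p w x ≠ 0 := by
  intro h0
  rw [lintegral_eq_zero_iff'
    ((aemeasurable_dualWeight hpm hwm).mono_measure (Measure.restrict_mono_set _ hIJ))] at h0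
  refine hvol (Measure.restrict_eq_zero.1 (ae_eq_bot.1 ?_))
  rw [← Filter.eventually_false_iff_eq_bot]
  filter_upwards [h0, ae_restrict_of_ae_restrict_of_subset hIJ hw] with x hx hwx
  exact dualWeight_ne_zero hwx hx

theorem TwoWeightInequality.testingCondition {J : Set ℝ} (hJ : J.OrdConnected)
    (hJb : Bornology.IsBounded J) {p : ℝ → ℝ} {pminus pplus : ℝ} (hpminus : 1 < pminus)
    (hp : ∀ x ∈ J, pminus ≤ p x ∧ p x ≤ pplus) (hpLH : LogHolderOn J p)
    {α : ℝ} {v w : ℝ → ℝ}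
    (hvm : AEMeasurable v (volume.restrict J)) (hwm : AEMeasurable w (volume.restrict J))
    (hv : ∀ᵐ x ∂volume.restrict J, 0 ≤ v x) (hv0 : ¬ ∀ᵐ x ∂volume.restrict J, v x = 0)
    (hw : ∀ᵐ x ∂volume.restrict J, 0 < w x) (hDC : DoublingOn J (dualWeight p w))
    (h : TwoWeightInequality J p α v w) : TestingCondition J p α v w := by
  have hJm := hJ.measurableSet
  have hpm : AEMeasurable p (volume.restrict J) := hpLH.continuousOn.aemeasurable hJm
  -- Integrability comes first: the oscillation bound presupposes `σ(J) < ∞`.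
  have hfin := h.lintegral_dualWeight_lt_top hJ hJb hpminus hp hpm hvm hwm hv hv0 hw
  obtain ⟨c, hc, h⟩ := h
  have hpos := fun I (hIJ : I ⊆ J) (hvol : volume I ≠ 0) =>
    setLIntegral_dualWeight_ne_zero hpm hwm hw hIJ hvol
  have hvol0 : volume J ≠ 0 := by
    intro h0
    refine hv0 ?_
    rw [Measure.restrict_eq_zero.2 h0, ae_zero]
    exact Filter.eventually_bot
  obtain ⟨L, hL, hosc⟩ := exists_oscillation_bound hJ hJb hp hpLH hDC (hpos J le_rfl hvol0) hfin.ne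
  refine ⟨max 1 (2 * c) ^ pplus * Real.exp (L * (pplus + 1)), by positivity, fun I hI hIJ => ?_⟩
  have hIfin : ∫⁻ x in I, dualWeight p w x < ∞ := (lintegral_mono_set hIJ).trans_lt hfin
  refine ⟨?_, hIfin⟩
  by_cases hvol : volume I = 0
  · rw [Measure.restrict_eq_zero.2 hvol]
    simp
  obtain ⟨ε, -, hε, hεL⟩ := hosc I hI hIJ hvol
  have hne : I.Nonempty := by
    rw [nonempty_iff_ne_empty]
    rintro rfl
    simp at hvol
  obtain ⟨x₀, hx₀⟩ := hne
  exact lintegral_testing_le hJm (fun x hx => ⟨by linarith [hp x hx], (hp x hx).2⟩) hpm hwm hw hc h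
    hI hIJ hx₀ (hpos I hIJ hvol) hIfin.ne hL hε hεL

/-! ### Sufficiency of the testing condition -/

lemma setLIntegral_withDensity_restrict {J I : Set ℝ} (hI : MeasurableSet I) (hIJ : I ⊆ J)
    {u g : ℝ → ℝ≥0∞} (hu : AEMeasurable u (volume.restrict J))
    (hg : AEMeasurable g (volume.restrict J)) :
    ∫⁻ x in I, g x ∂(volume.restrict J).withDensity u = ∫⁻ x in I, g x * u x := by
  have hle : volume.restrict I ≤ volume.restrict J := Measure.restrict_mono_set _ hIJ
  rw [restrict_withDensity hI, Measure.restrict_restrict hI, inter_eq_self_of_subset_left hIJ,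
    lintegral_withDensity_eq_lintegral_mul₀ (hu.mono_measure hle) (hg.mono_measure hle)]
  simp only [Pi.mul_apply, mul_comm]

lemma withDensity_restrict_apply {J I : Set ℝ} (hI : MeasurableSet I) (hIJ : I ⊆ J)
    (u : ℝ → ℝ≥0∞) : (volume.restrict J).withDensity u I = ∫⁻ x in I, u x := by
  rw [withDensity_apply _ hI, Measure.restrict_restrict hI, inter_eq_self_of_subset_left hIJ]

/-- A countable family `B` of subintervals of `J` which approximates every subinterval from
outside, with enlargements `K` of comparable mass suited to a Vitali covering argument. -/
lemma exists_countable_intervals {J : Set ℝ} (hJ : J.OrdConnected) (hJb : Bornology.IsBounded J)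
    {u : ℝ → ℝ≥0∞} {N : ℕ}
    (hN : ∀ x ∈ J, ∀ r : ℝ, 0 < r →
      ∫⁻ y in Ioo (x - 2 * r) (x + 2 * r) ∩ J, u y ≤
        2 ^ N * ∫⁻ y in Ioo (x - r) (x + r) ∩ J, u y) :
    ∃ (ι : Type) (_ : Countable ι) (B K : ι → Set ℝ) (δ : ι → ℝ),
      (∀ i, (B i).OrdConnected) ∧ (∀ i, B i ⊆ J) ∧ (∀ i, volume (B i) ≠ 0) ∧
      (∀ i, (K i).OrdConnected) ∧ (∀ i, K i ⊆ J) ∧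
      (∀ i, 0 ≤ δ i) ∧ (∀ i, δ i ≤ (volume J).toReal) ∧
      (∀ i j, (B j ∩ B i).Nonempty → δ j ≤ 2 * δ i → B j ⊆ K i) ∧
      (∀ i, ∫⁻ x in K i, u x ≤ (2 ^ 3) ^ N * ∫⁻ x in B i, u x) ∧
      (∀ I : Set ℝ, I.OrdConnected → I ⊆ J → volume I ≠ 0 →
        ∃ i, I ⊆ B i ∧ volume (B i) ≤ 2 * volume I) := by
  let ι := {z : ℚ × ℚ // volume (Ioo (z.1 : ℝ) z.2 ∩ J) ≠ 0}
  let B : ι → Set ℝ := fun z => Ioo (z.1.1 : ℝ) z.1.2 ∩ J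
  have hB : ∀ i, (B i).OrdConnected := fun i => ordConnected_Ioo.inter hJ
  have hBJ : ∀ i, B i ⊆ J := fun i => inter_subset_right
  choose c r hr hc h1 h2 h3 using fun i : ι => exists_center (hB i) (hJb.subset (hBJ i)) i.2
  -- `δ` is the half-length. If `B j` meets `B i` and `r j ≤ 2 * r i`, points of `B j` are within `2
  -- * r j + r i ≤ 5 * r i` of `c i`; the radius `2 ^ 3 * r i` of `K i` is the next dyadic multiple.
  refine ⟨ι, inferInstance, B, fun i => Ioo (c i - 2 ^ 3 * r i) (c i + 2 ^ 3 * r i) ∩ J, r, hB, hBJ,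
    fun i => i.2, fun i => ordConnected_Ioo.inter hJ, fun i => inter_subset_right,
    fun i => (hr i).le, fun i => ?_, fun i j hij hδ => ?_, fun i => ?_, fun I hI hIJ hvol => ?_⟩
  · have h4 : ENNReal.ofReal (2 * r i) ≤ volume J := (h3 i).symm.trans_le (measure_mono (hBJ i))
    have := (ENNReal.ofReal_le_iff_le_toReal (volume_ne_top_of_bounded hJb)).1 h4
    linarith [hr i]
  · obtain ⟨z, hzj, hzi⟩ := hij
    intro y hy
    have hy' := h2 j hy
    have hzj' := h2 j hzj
    have hzi' := h2 i hzi
    have hri := hr i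
    simp only [mem_Icc] at hy' hzj' hzi'
    exact ⟨⟨by linarith, by linarith⟩, hBJ j hy⟩
  · refine (lintegral_Ioo_two_pow_le hN (hBJ i (hc i)) (hr i) 3).trans ?_
    gcongr
    exact inter_subset_left.trans (h1 i)
  · obtain ⟨d, s, hs, -, h4, h5, h6⟩ := exists_center hI (hJb.subset hIJ) hvol
    obtain ⟨a, ha1, ha2⟩ := exists_rat_btwn (by linarith : d - 2 * s < d - s)
    obtain ⟨b, hb1, hb2⟩ := exists_rat_btwn (by linarith : d + s < d + 2 * s)
    have hsub : I ⊆ Ioo (a : ℝ) b ∩ J := fun x hx =>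
      ⟨⟨by linarith [(h5 hx).1], by linarith [(h5 hx).2]⟩, hIJ hx⟩
    refine ⟨⟨(a, b), fun h0 => hvol (measure_mono_null hsub h0)⟩, hsub, ?_⟩
    calc volume (Ioo (a : ℝ) b ∩ J) ≤ volume (Ioo (a : ℝ) b) := measure_mono inter_subset_left
      _ = ENNReal.ofReal (b - a) := Real.volume_Ioo
      _ ≤ ENNReal.ofReal (2 * (2 * s)) := ENNReal.ofReal_le_ofReal (by linarith)
      _ = 2 * volume I := by
        rw [h6, ENNReal.ofReal_mul two_pos.le, ENNReal.ofReal_ofNat]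

/-- The modular form of the sufficiency of the testing condition. -/
lemma exists_modular_fracMaximal_le {J : Set ℝ} (hJ : J.OrdConnected)
    (hJb : Bornology.IsBounded J) {p : ℝ → ℝ} {pminus pplus : ℝ} (hpminus : 1 < pminus)
    (hp : ∀ x ∈ J, pminus ≤ p x ∧ p x ≤ pplus) (hpLH : LogHolderOn J p)
    {α : ℝ} (hα0 : 0 ≤ α) (hα1 : α < 1) {v w : ℝ → ℝ}
    (hvm : AEMeasurable v (volume.restrict J)) (hwm : AEMeasurable w (volume.restrict J))
    (hvol0 : volume J ≠ 0)
    (hw : ∀ᵐ x ∂volume.restrict J, 0 < w x) (hDC : DoublingOn J (dualWeight p w))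
    (h : TestingCondition J p α v w) :
    ∃ C : ℝ≥0∞, C ≠ ∞ ∧ ∀ F : ℝ → ℝ≥0∞, AEMeasurable F (volume.restrict J) →
      modular J p (fun x => ENNReal.ofReal (w x) * F x) ≤ 1 →
      modular J p (fun x => ENNReal.ofReal (v x) * fracMaximal J α F x) ≤ C := by
  obtain ⟨c, hc, htest⟩ := h
  have hJm := hJ.measurableSet
  have hpm : AEMeasurable p (volume.restrict J) := hpLH.continuousOn.aemeasurable hJm
  have hσm := aemeasurable_dualWeight hpm hwm
  have hfin := (htest J hJ le_rfl).2
  have hpos := fun I (hIJ : I ⊆ J) (hvol : volume I ≠ 0) =>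
    setLIntegral_dualWeight_ne_zero hpm hwm hw hIJ hvol
  obtain ⟨L, hL, hosc⟩ := exists_oscillation_bound hJ hJb hp hpLH hDC (hpos J le_rfl hvol0) hfin.ne
  obtain ⟨N, hN⟩ := hDC.exists_pow hJ hJb
  obtain ⟨ι, _, B, K, δ, hBo, hBJ, hBv, hKo, hKJ, hδ0, hδR, hBK, hKB, happ⟩ :=
    exists_countable_intervals hJ hJb hN
  set σ := dualWeight p w with hσ
  set ν := (volume.restrict J).withDensity σ with hν
  have hνac : ν ≪ volume.restrict J := withDensity_absolutelyContinuous _ _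
  have : IsFiniteMeasure ν := isFiniteMeasure_withDensity hfin.ne
  have hνapp : ∀ I : Set ℝ, I.OrdConnected → I ⊆ J → ν I = ∫⁻ x in I, σ x := fun I hI hIJ =>
    withDensity_restrict_apply hI.measurableSet hIJ σ
  have hνB0 : ∀ i, ν (B i) ≠ 0 := fun i => by
    rw [hνapp _ (hBo i) (hBJ i)]
    exact hpos _ (hBJ i) (hBv i)
  -- With `F = g σ`, the fractional average of `F` over `B i` is `s i` times the `ν`-average of `g`.
  set s : ι → ℝ≥0∞ := fun i => ν (B i) / volume (B i) ^ (1 - α) with hs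
  set φ : ι → ℝ → ℝ≥0∞ := fun i =>
    (B i).indicator fun x => ENNReal.ofReal (v x) ^ p x * s i ^ p x with hφ
  have hφm : ∀ i, AEMeasurable (φ i) (volume.restrict J) := fun i =>
    ((hvm.ennreal_ofReal.pow hpm).mul (aemeasurable_const.pow hpm)).indicator
      (hBo i).measurableSet
  -- For `B j ⊆ K i`, the number `s j` is one of the competitors in `M_α (σ χ_{K i})` at points of
  -- `B j`, so testing on `K i` controls the whole supremum.
  have hφtest : ∀ i, ∫⁻ x in J, ⨆ j, ⨆ (_ : B j ⊆ K i), φ j x ≤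
      ENNReal.ofReal c * ν (K i) := by
    intro i
    calc ∫⁻ x in J, ⨆ j, ⨆ (_ : B j ⊆ K i), φ j x
        ≤ ∫⁻ x in J, (K i).indicator (fun x => ENNReal.ofReal (v x) ^ p x *
            fracMaximal J α ((K i).indicator σ) x ^ p x) x := by
          refine setLIntegral_mono' hJm fun x hxJ => iSup₂_le fun j hj => ?_
          by_cases hx : x ∈ B j
          · have hpx : 0 ≤ p x := by linarith [hp x hxJ]
            have hsM : s j ≤ fracMaximal J α ((K i).indicator σ) x := by
              refine le_trans (le_of_eq ?_) (le_fracMaximal (hBo j) hx (hBJ j))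
              simp only [hs]
              rw [hνapp _ (hBo j) (hBJ j), setLIntegral_indicator (hKo i).measurableSet,
                inter_eq_self_of_subset_right hj]
            simp only [hφ]
            rw [indicator_of_mem hx, indicator_of_mem (hj hx)]
            gcongr
          · simp only [hφ]
            rw [indicator_of_notMem hx]
            exact zero_le
      _ = ∫⁻ x in K i, ENNReal.ofReal (v x) ^ p x *
            fracMaximal J α ((K i).indicator σ) x ^ p x := by
          rw [setLIntegral_indicator (hKo i).measurableSet,
            inter_eq_self_of_subset_left (hKJ i)]
      _ ≤ ENNReal.ofReal c * ν (K i) := by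
          rw [hνapp _ (hKo i) (hKJ i)]
          exact (htest _ (hKo i) (hKJ i)).1
  have hνK : ∀ i, ν (K i) ≤ (2 ^ 3) ^ N * ν (B i) := fun i => by
    rw [hνapp _ (hKo i) (hKJ i), hνapp _ (hBo i) (hBJ i)]
    exact hKB i
  have hBne : ∀ i, (B i).Nonempty := fun i => by
    rw [nonempty_iff_ne_empty]
    intro h0
    exact hBv i (by rw [h0, measure_empty])
  set q := pminus with hq
  have hq0 : 0 < q := by linarith
  set E : ℝ≥0∞ := ENNReal.ofReal (2 ^ pplus * Real.exp L) with hE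
  have hET : E ≠ ∞ := ENNReal.ofReal_ne_top
  set C₁ : ℝ≥0∞ := ENNReal.ofReal c * (2 ^ 3) ^ N * 2 with hC₁
  have hC₁T : C₁ ≠ ∞ := by
    refine ENNReal.mul_ne_top (ENNReal.mul_ne_top ENNReal.ofReal_ne_top ?_) (by simp)
    exact ENNReal.pow_ne_top (by simp)
  refine ⟨2 ^ pplus * (C₁ * ENNReal.ofReal q * (ENNReal.ofReal (q - 1))⁻¹ *
    ((2 * E) ^ q * (2 ^ (q - 1) * (1 + ν univ)))), ?_, fun F hF hmod => ?_⟩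
  · have h1 : (ENNReal.ofReal (q - 1))⁻¹ ≠ ∞ := by simpa using hpminus
    have hp20 : 0 ≤ pplus := by
      obtain ⟨z, hz⟩ : J.Nonempty := nonempty_of_measure_ne_zero hvol0
      linarith [hp z hz]
    have h2 : (2 : ℝ≥0∞) ^ pplus ≠ ∞ := ENNReal.rpow_ne_top_of_nonneg hp20 (by simp)
    have h3 : (2 : ℝ≥0∞) ^ (q - 1) ≠ ∞ := ENNReal.rpow_ne_top_of_nonneg (by linarith) (by simp)
    have h4 : (2 * E) ^ q ≠ ∞ := ENNReal.rpow_ne_top_of_nonneg hq0.le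
      (ENNReal.mul_ne_top (by simp) hET)
    have h5 : 1 + ν univ ≠ ∞ := ENNReal.add_ne_top.2 ⟨by simp, measure_ne_top _ _⟩
    exact ENNReal.mul_ne_top h2 (ENNReal.mul_ne_top (ENNReal.mul_ne_top
      (ENNReal.mul_ne_top hC₁T ENNReal.ofReal_ne_top) h1)
      (ENNReal.mul_ne_top h4 (ENNReal.mul_ne_top h3 h5)))
  set g : ℝ → ℝ≥0∞ := fun x => F x / σ x with hg
  have hgm : AEMeasurable g (volume.restrict J) := hF.div hσm
  have hgF : ∀ᵐ x ∂volume.restrict J, g x * σ x = F x := by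
    filter_upwards [hw] with x hwx
    exact ENNReal.div_mul_cancel (dualWeight_ne_zero hwx) (dualWeight_ne_top hwx)
  have hgp : ∫⁻ x, g x ^ p x ∂ν ≤ 1 := by
    have h1 := setLIntegral_withDensity_restrict hJm le_rfl hσm (hgm.pow hpm)
    have h2 : ν.restrict J = ν := by
      rw [hν, restrict_withDensity hJm, Measure.restrict_restrict hJm, inter_self]
    rw [← hν, h2] at h1
    refine h1.trans_le (le_trans (le_of_eq ?_) hmod)
    refine lintegral_congr_ae ?_
    filter_upwards [hw, hgF, ae_restrict_mem hJm] with x hwx hgx hxJ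
    rw [← hgx, hσ, ofReal_mul_dualWeight_rpow (by linarith [hp x hxJ]) hwx]
  -- The exponent `p x / q` makes `G ^ q` comparable with `g ^ p + 1`, whose `ν`-integral is at most
  -- `1 + ν univ`.
  set G : ℝ → ℝ≥0∞ := fun x => E * (g x ^ (p x / q) + 1) with hG
  have hgpq : AEMeasurable (fun x => g x ^ (p x / q)) ν :=
    (hgm.pow (hpm.div_const q)).mono_ac hνac
  have hGm : AEMeasurable G ν := (hgpq.add_const 1).const_mul E
  set A : ι → ℝ≥0∞ := fun i => (∫⁻ y in B i, G y ∂ν) / ν (B i) with hA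
  have havg : ∀ i, ∀ x ∈ B i,
      ((∫⁻ y in B i, F y) / volume (B i) ^ (1 - α)) ^ p x ≤ s i ^ p x * A i ^ q := by
    intro i x hx
    have hpx := hp x (hBJ i hx)
    have hpx0 : 0 ≤ p x := by linarith
    have hFg : ∫⁻ y in B i, F y = ∫⁻ y in B i, g y ∂ν := by
      rw [hν, setLIntegral_withDensity_restrict (hBo i).measurableSet (hBJ i) hσm hgm]
      refine lintegral_congr_ae ?_
      filter_upwards [ae_restrict_of_ae_restrict_of_subset (hBJ i) hgF] with y hy
      exact hy.symm
    set μ := ProbabilityTheory.cond ν (B i) with hμ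
    have : IsProbabilityMeasure μ := ProbabilityTheory.cond_isProbabilityMeasure (hνB0 i)
    have hμint : ∀ f : ℝ → ℝ≥0∞, ∫⁻ y, f y ∂μ = (∫⁻ y in B i, f y ∂ν) / ν (B i) := fun f => by
      rw [hμ, ProbabilityTheory.cond, lintegral_smul_measure, smul_eq_mul, mul_comm,
        div_eq_mul_inv]
    have hμac : μ ≪ ν := ProbabilityTheory.cond_absolutelyContinuous
    obtain ⟨ε, hε0, hε, hεL⟩ := hosc (B i) (hBo i) (hBJ i) (hBv i)
    rw [← hνapp _ (hBo i) (hBJ i)] at hεL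
    have hkey := rpow_lintegral_le_of_oscillation μ ((hgm.mono_ac hνac).mono_ac hμac)
      hpminus.le hpx.1 hpx.2 hε0 (abs_nonneg _) hεL (p := p) ?_ ?_
    · have e1 : (∫⁻ y in B i, F y) / volume (B i) ^ (1 - α) = s i * ∫⁻ y, g y ∂μ := by
        rw [hFg, hμint]
        simp only [hs, div_eq_mul_inv]
        calc _ = (ν (B i) * (ν (B i))⁻¹) * ((∫⁻ y in B i, g y ∂ν) *
              (volume (B i) ^ (1 - α))⁻¹) := by
              rw [ENNReal.mul_inv_cancel (hνB0 i) (measure_ne_top _ _), one_mul]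
          _ = _ := by ring
      have e2 : A i = E * (∫⁻ y, g y ^ (p y / q) ∂μ + 1) := by
        simp only [hA]
        rw [← hμint]
        simp only [hG]
        rw [lintegral_const_mul' _ _ hET,
          lintegral_add_right _ measurable_const]
        simp
      rw [e1, ENNReal.mul_rpow_of_nonneg _ _ hpx0, e2]
      gcongr
    · have : ∀ᵐ y ∂μ, y ∈ B i := ProbabilityTheory.ae_cond_mem (hBo i).measurableSet
      filter_upwards [this] with y hy
      have := abs_le.1 (hε x hx y hy)
      exact ⟨(hp y (hBJ i hy)).1, by linarith⟩
    -- The modular of `g` is at most `1`, so its average over `B i` is at most `1 / ν (B i) ≤ exp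
    -- |log ν (B i)|`; this is the `H` paired with `ε` in the oscillation bound.
    · rw [hμint]
      have hνpos : 0 < (ν (B i)).toReal := ENNReal.toReal_pos (hνB0 i) (measure_ne_top _ _)
      calc (∫⁻ y in B i, g y ^ p y ∂ν) / ν (B i) ≤ 1 / ν (B i) := by
            gcongr
            exact (setLIntegral_le_lintegral _ _).trans hgp
        _ = ENNReal.ofReal ((ν (B i)).toReal)⁻¹ := by
            rw [ENNReal.ofReal_inv_of_pos hνpos, ENNReal.ofReal_toReal (measure_ne_top _ _),
              one_div]
        _ ≤ _ := by
            refine ENNReal.ofReal_le_ofReal ?_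
            rw [← Real.exp_log (inv_pos.2 hνpos), Real.log_inv]
            exact Real.exp_le_exp.2 (neg_le_abs _)
  set Y : ℝ → ℝ≥0∞ := fun x => ⨆ i, φ i x * A i ^ q with hY
  have hpt : ∀ x ∈ J, (ENNReal.ofReal (v x) * fracMaximal J α F x) ^ p x ≤ 2 ^ pplus * Y x := by
    intro x hxJ
    have hpx := hp x hxJ
    have hpx0 : 0 < p x := by linarith
    have h1 : ENNReal.ofReal (v x) * fracMaximal J α F x ≤ 2 * Y x ^ (1 / p x) := by
      simp only [fracMaximal, ENNReal.mul_iSup]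
      refine iSup_le fun I => iSup_le fun hI => iSup_le fun hxI => iSup_le fun hIJ => ?_
      by_cases hvol : volume I = 0
      · rw [Measure.restrict_eq_zero.2 hvol]
        simp
      obtain ⟨i, hIB, hvB⟩ := happ I hI hIJ hvol
      have h2 : (∫⁻ y in I, F y) / volume I ^ (1 - α) ≤
          2 * ((∫⁻ y in B i, F y) / volume (B i) ^ (1 - α)) := by
        -- Here `0 ≤ α` gives `2 ^ (1 - α) ≤ 2`.
        have h3 : volume (B i) ^ (1 - α) ≤ 2 * volume I ^ (1 - α) := by
          calc volume (B i) ^ (1 - α) ≤ (2 * volume I) ^ (1 - α) :=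
                ENNReal.rpow_le_rpow hvB (by linarith)
            _ = 2 ^ (1 - α) * volume I ^ (1 - α) :=
                ENNReal.mul_rpow_of_nonneg _ _ (by linarith)
            _ ≤ 2 ^ (1 : ℝ) * volume I ^ (1 - α) := by
                gcongr
                · norm_num
                · linarith
            _ = _ := by rw [ENNReal.rpow_one]
        calc (∫⁻ y in I, F y) / volume I ^ (1 - α)
            = 2 * ((∫⁻ y in I, F y) / (2 * volume I ^ (1 - α))) := by
              rw [← mul_div_assoc, ENNReal.mul_div_mul_left _ _ (by simp) (by simp)]
          _ ≤ _ := by gcongr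
      have h4 : ENNReal.ofReal (v x) * ((∫⁻ y in B i, F y) / volume (B i) ^ (1 - α)) ≤
          Y x ^ (1 / p x) := by
        rw [one_div, ENNReal.le_rpow_inv_iff hpx0, ENNReal.mul_rpow_of_nonneg _ _ hpx0.le]
        refine le_trans ?_ (le_iSup _ i)
        simp only [hφ]
        rw [indicator_of_mem (hIB hxI), mul_assoc]
        gcongr
        exact havg i x (hIB hxI)
      calc _ ≤ ENNReal.ofReal (v x) *
            (2 * ((∫⁻ y in B i, F y) / volume (B i) ^ (1 - α))) := by gcongr
        _ = 2 * (ENNReal.ofReal (v x) * ((∫⁻ y in B i, F y) / volume (B i) ^ (1 - α))) := by ring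
        _ ≤ _ := by gcongr
    calc _ ≤ (2 * Y x ^ (1 / p x)) ^ p x := by gcongr
      _ = 2 ^ p x * Y x := by
        rw [ENNReal.mul_rpow_of_nonneg _ _ hpx0.le, ← ENNReal.rpow_mul,
          one_div_mul_cancel hpx0.ne', ENNReal.rpow_one]
      _ ≤ _ := by
        gcongr
        · norm_num
        · exact hpx.2
  have hp2 : (2 : ℝ≥0∞) ^ pplus ≠ ∞ := by
    obtain ⟨z, hz⟩ : J.Nonempty := nonempty_of_measure_ne_zero hvol0
    exact ENNReal.rpow_ne_top_of_nonneg (by linarith [hp z hz]) (by simp)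
  calc modular J p (fun x => ENNReal.ofReal (v x) * fracMaximal J α F x)
      ≤ ∫⁻ x in J, 2 ^ pplus * Y x := setLIntegral_mono' hJm hpt
    _ = 2 ^ pplus * ∫⁻ x in J, Y x := lintegral_const_mul' _ _ hp2
    _ ≤ 2 ^ pplus * (C₁ * ENNReal.ofReal q * (ENNReal.ofReal (q - 1))⁻¹ *
          ∫⁻ y, (2 * G y) ^ q ∂ν) := by
        gcongr
        exact lintegral_iSup_mul_rpow_le hφm A hGm hpminus hC₁T fun t ht =>
          lintegral_iSup_indicator_le (fun i => (hBo i).measurableSet) hBne hδ0 hδR hBK hφm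
            hφtest hνK ht
    _ ≤ _ := by
        gcongr
        calc ∫⁻ y, (2 * G y) ^ q ∂ν
            ≤ ∫⁻ y, (2 * E) ^ q * (2 ^ (q - 1) * (g y ^ p y + 1)) ∂ν := by
              refine lintegral_mono fun y => ?_
              simp only [hG]
              rw [← mul_assoc, ENNReal.mul_rpow_of_nonneg _ _ hq0.le]
              gcongr
              refine (ENNReal.rpow_add_le_mul_rpow_add_rpow _ _ hpminus.le).trans_eq ?_
              rw [← ENNReal.rpow_mul, div_mul_cancel₀ _ hq0.ne', ENNReal.one_rpow]
          _ = (2 * E) ^ q * (2 ^ (q - 1) * (∫⁻ y, g y ^ p y ∂ν + ν univ)) := by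
              rw [lintegral_const_mul' _ _ (ENNReal.rpow_ne_top_of_nonneg hq0.le
                  (ENNReal.mul_ne_top (by simp) hET)),
                lintegral_const_mul' _ _ (ENNReal.rpow_ne_top_of_nonneg (by linarith) (by simp)),
                lintegral_add_right _ measurable_const]
              simp
          _ ≤ _ := by gcongr

lemma fracMaximal_div {J : Set ℝ} {α : ℝ} (g : ℝ → ℝ≥0∞) {a : ℝ≥0∞} (ha : a ≠ 0) (x : ℝ) :
    fracMaximal J α (fun y => g y / a) x = fracMaximal J α g x / a := by
  simp only [fracMaximal, div_eq_mul_inv, ENNReal.iSup_mul,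
    lintegral_mul_const' _ _ (ENNReal.inv_ne_top.2 ha), mul_right_comm]

theorem TestingCondition.twoWeightInequality {J : Set ℝ} (hJ : J.OrdConnected)
    (hJb : Bornology.IsBounded J) {p : ℝ → ℝ} {pminus pplus : ℝ} (hpminus : 1 < pminus)
    (hp : ∀ x ∈ J, pminus ≤ p x ∧ p x ≤ pplus) (hpLH : LogHolderOn J p)
    {α : ℝ} (hα0 : 0 ≤ α) (hα1 : α < 1) {v w : ℝ → ℝ}
    (hvm : AEMeasurable v (volume.restrict J)) (hwm : AEMeasurable w (volume.restrict J))
    (hvol0 : volume J ≠ 0)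
    (hw : ∀ᵐ x ∂volume.restrict J, 0 < w x) (hDC : DoublingOn J (dualWeight p w))
    (h : TestingCondition J p α v w) : TwoWeightInequality J p α v w := by
  have hJm := hJ.measurableSet
  obtain ⟨C, hCT, hC⟩ := exists_modular_fracMaximal_le hJ hJb hpminus hp hpLH hα0 hα1 hvm hwm
    hvol0 hw hDC h
  -- Since `D ≥ 1` and `p x ≥ 1`, dividing the function by `D` divides the modular by at least `D ≥
  -- C`, which turns the modular bound `C` into the bound `1` required by the norm.
  set D : ℝ≥0 := max 1 C.toNNReal with hD
  have hD1 : 1 ≤ D := le_max_left _ _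
  have hD0 : 0 < D := one_pos.trans_le hD1
  have hD0' : (D : ℝ≥0∞) ≠ 0 := by simpa using hD0.ne'
  have hCD : C ≤ D := by
    rw [← ENNReal.coe_toNNReal hCT]
    exact_mod_cast le_max_right _ _
  refine ⟨D, by exact_mod_cast hD0, fun f hf => ?_⟩
  rw [ENNReal.ofReal_coe_nnreal]
  have hmain : ∀ l : ℝ≥0, 0 < l →
      modular J p (fun x => ENNReal.ofReal (w x) * ‖f x‖ₑ / (l : ℝ≥0∞)) ≤ 1 →
      lpNorm J p (fun x => ENNReal.ofReal (v x) * fracMaximal J α (fun y => ‖f y‖ₑ) x) ≤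
        D * l := by
    intro l hl hmod
    have hl' : (l : ℝ≥0∞) ≠ 0 := by simpa using hl.ne'
    have h1 := hC (fun x => ‖f x‖ₑ / l) (hf.enorm.div_const _) (by
      simpa only [mul_div_assoc] using hmod)
    have h2 := lpNorm_le (J := J) (p := p) (l := D * l) (mul_pos hD0 hl)
      (g := fun x => ENNReal.ofReal (v x) * fracMaximal J α (fun y => ‖f y‖ₑ) x) ?_
    · simpa using h2
    · calc _ ≤ ∫⁻ x in J, (ENNReal.ofReal (v x) *
              fracMaximal J α (fun x => ‖f x‖ₑ / l) x) ^ p x * (D : ℝ≥0∞)⁻¹ := by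
            refine setLIntegral_mono' hJm fun x hx => ?_
            have hpx : 1 ≤ p x := by linarith [hp x hx]
            have e : ENNReal.ofReal (v x) * fracMaximal J α (fun y => ‖f y‖ₑ) x /
                ((D * l : ℝ≥0) : ℝ≥0∞) = ENNReal.ofReal (v x) *
                fracMaximal J α (fun x => ‖f x‖ₑ / l) x * (D : ℝ≥0∞)⁻¹ := by
              rw [fracMaximal_div _ hl', ENNReal.coe_mul, div_eq_mul_inv, div_eq_mul_inv,
                ENNReal.mul_inv (Or.inl hD0') (Or.inl ENNReal.coe_ne_top)]
              ring
            beta_reduce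
            rw [e, ENNReal.mul_rpow_of_nonneg _ _ (by linarith)]
            gcongr
            calc (D : ℝ≥0∞)⁻¹ ^ p x ≤ (D : ℝ≥0∞)⁻¹ ^ (1 : ℝ) := by
                  refine ENNReal.rpow_le_rpow_of_exponent_ge ?_ hpx
                  rw [ENNReal.inv_le_one]
                  exact_mod_cast hD1
              _ = _ := ENNReal.rpow_one _
        _ = modular J p (fun x => ENNReal.ofReal (v x) *
              fracMaximal J α (fun x => ‖f x‖ₑ / l) x) * (D : ℝ≥0∞)⁻¹ :=
            lintegral_mul_const' _ _ (ENNReal.inv_ne_top.2 hD0')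
        _ ≤ D * (D : ℝ≥0∞)⁻¹ := by
            gcongr
            exact h1.trans hCD
        _ = 1 := ENNReal.mul_inv_cancel hD0' ENNReal.coe_ne_top
  rw [mul_comm, ← ENNReal.div_le_iff_le_mul (Or.inl hD0') (Or.inl ENNReal.coe_ne_top)]
  refine le_iInf fun l => le_iInf₂ fun hl hmod => ?_
  rw [ENNReal.div_le_iff_le_mul (Or.inl hD0') (Or.inl ENNReal.coe_ne_top), mul_comm]
  exact hmain l hl hmod

end VarExp

theorem theorem1p1 (J : Set ℝ) (hJ : J.OrdConnected) (hJb : Bornology.IsBounded J)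
    (p : ℝ → ℝ) (pminus pplus : ℝ) (hpminus : 1 < pminus)
    (hp : ∀ x ∈ J, pminus ≤ p x ∧ p x ≤ pplus) (hpLH : VarExp.LogHolderOn J p)
    (α : ℝ) (hα0 : 0 ≤ α) (hα1 : α < 1)
    (v w : ℝ → ℝ)
    (hvm : AEMeasurable v (volume.restrict J)) (hwm : AEMeasurable w (volume.restrict J))
    (hv : ∀ᵐ x ∂volume.restrict J, 0 ≤ v x) (hv0 : ¬ ∀ᵐ x ∂volume.restrict J, v x = 0)
    (hw : ∀ᵐ x ∂volume.restrict J, 0 < w x)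
    (hDC : VarExp.DoublingOn J (VarExp.dualWeight p w)) :
    VarExp.TwoWeightInequality J p α v w ↔ VarExp.TestingCondition J p α v w := by
  refine ⟨fun h => h.testingCondition hJ hJb hpminus hp hpLH hvm hwm hv hv0 hw hDC, fun h =>
    h.twoWeightInequality hJ hJb hpminus hp hpLH hα0 hα1 hvm hwm (fun h0 => hv0 ?_) hw hDC⟩
  rw [Measure.restrict_eq_zero.2 h0, ae_zero]
  exact Filter.eventually_bot
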